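/- **Setting.** Let $X=(X_t)_{t\in\mathbb R}$ be an $\mathbb R^n$-valued bilateral, time-homogeneous Markov process (with respect to its natural filtration) with forward and backward transition functions $p_t(x,B)=\mathbb P\{X_{s+t}\in B\mid X_s=x\}$ and $\tilde p_t(x,B)=\mathbb P\{X_{s-t}\in B\mid X_s=x\}$, $t\ge 0$, which are probability kernels. A measure $\mu$ is called invariant for $X$ if $\mu(B)=\int p_t(x,B)\,\mu(dx)=\int\tilde p_t(x,B)\,\mu(dx)$ for all $t$ and all Borel sets $B$, where moreover either $\mathbb P$ is a probability measure and $\mu$ is absolutely continuous with respect to the law of each $X_s$ (so that $p_t(x,\cdot)$ and $\tilde p_t(x,\cdot)$ are determined for $\mu$-a.e. $x$), or $X$ is an improper process: $\mathbb P$ is a possibly infinite measure and $\mu$ is the law of $X_s$ for every $s$. On the complex space $L^2(\mathbb R^n,d\mu)$, whose scalar product is linear in the second argument, put $T_tf=\int f(y)\,p_t(\cdot,dy)$ and $\tilde T_tf=\int f(y)\,\tilde p_t(\cdot,dy)$, and let $(L,D(L))$, $(\tilde L,D(\tilde L))$ be their infinitesimal generators. **Hypotheses.** 1. $X$ has an absolutely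 continuous invariant measure $\mu(dx)=\rho(x)\,dx$. 2. $\rho>0$ Lebesgue-a.e. 3. $D(L)\cap D(\tilde L)$ is dense in $L^2(\mathbb R^n,d\mu)$. 4. There is $C\in\mathbb R$ with $-\Re\langle\varphi,L\varphi\rangle_\mu+\Im\langle\varphi,L\varphi\rangle_\mu\ge C\|\varphi\|_\mu^2$ for all $\varphi\in D(L)$. **Operators.** Let $H^1$ be the space of the absolutely continuous functions in $L^2(\mathbb R,dt)$ with derivative in $L^2(\mathbb R,dt)$, the domain of $\partial_t$. Below, $\otimes$ of subspaces is the algebraic tensor product (the span of the product functions $f(x)g(t)$), and for operators $A$, $B$ the operator $A\otimes B$ has domain $D(A)\otimes D(B)$. Let $Y_t=(X_t,t)$ be the space-time process, and let $L^Y,\tilde L^Y$ be its forward and backward generators in $L^2(\mathbb R^{n+1},d\mu\,dt)$, that is the generators of $(x,s)\mapsto\int f(y,s+t)\,p_t(x,dy)$ and $(x,s)\mapsto\int f(y,s-t)\,\tilde p_t(x,dy)$, taken with the domains $D(L)\otimes H^1$ and $D(\tilde L)\otimes H^1$. Set $$K^Y=-\frac{\tilde L^Y+iL^Y}{i+1}\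 \text{ on } D(L^Y)\cap D(\tilde L^Y),\qquad K=-\frac{\tilde L+iL}{i+1}\ \text{ on } D(L)\cap D(\tilde L).$$ Given a measurable $S:\mathbb R^n\to\mathbb R$ and $E\in\mathbb R$, let $\psi(x)=\sqrt{\rho(x)}\,e^{iS(x)}$ and $\Psi(x,t)=\psi(x)e^{-iEt}$. Let $U_\psi f=f\psi$ and $U_\Psi f=f\Psi$ be the unitary operators $L^2(d\mu)\to L^2(dx)$ and $L^2(d\mu\,dt)\to L^2(dx\,dt)$, and let $K_\psi=U_\psi KU_\psi^{-1}$, $K^Y_\Psi=U_\Psi K^YU_\Psi^{-1}$ be the Doob transforms, with domains $U_\psi D(K)$ and $U_\Psi D(K^Y)$. **Proposition 5.2.** Under the hypotheses 1–4, for all such $S$ and $E$: * $K^Y_\Psi=H_0\otimes I-i\,I\otimes\partial_t$ (equality of operators, domains included), where $H_0=K_\psi+E$. * $H_0$ is densely defined, symmetric and bounded from below in $L^2(\mathbb R^n,dx)$. Its Friedrichs extension $H$ (the restriction of $H_0^\dagger$ to the form domain of $H_0$) is a self-adjoint, bounded from below extension of $H_0$. * If $\psi\in L^2(\mathbb R^n,dx)$,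 equivalently $\mu(\mathbb R^n)<\infty$, then $\psi$ is an eigenvector of $H$ with eigenvalue $E$: $\psi\neq0$, $\psi\in D(H)$ and $H\psi=E\psi$. Moreover $\Psi$ is a strong solution of $i\partial_t\Psi=H\Psi$: for every $t\in\mathbb R$ one has $\Psi(\cdot,t)\in D(H)$, $H\Psi(\cdot,t)=E\,\Psi(\cdot,t)$, and $t\mapsto\Psi(\cdot,t)$ is differentiable in the norm of $L^2(\mathbb R^n,dx)$ with $i\partial_t\Psi(\cdot,t)=H\Psi(\cdot,t)$. -/

import Mathlib

open MeasureTheory ProbabilityTheory Filter Topology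
open scoped ENNReal NNReal

noncomputable section

namespace DoobSchrodinger

/-! ### Bilateral Markov processes and invariant measures -/

section MarkovProcess

variable {Ω α : Type*} [MeasurableSpace Ω] [MeasurableSpace α]

/-- `X = (X_t)_{t ∈ ℝ}` is a bilateral, time-homogeneous Markov process under `P` (with respect to
its natural filtration) with forward transition function `p` and backward transition function `q`:
conditionally on the past up to time `s`, the law of `X (s + t)` is `p t (X s)`, and conditionally
on the future from time `s` on, the law of `X (s - t)` is `q t (X s)`. The measure `P` need not be
finite (improper processes), so the conditional laws are written in integrated form. -/
structure IsBilateralMarkov (P : Measure Ω) (X : ℝ → Ω → α) (p q : ℝ≥0 → Kernel α α) : Prop where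
  measurable : ∀ t, Measurable (X t)
  forward : ∀ (s : ℝ) (t : ℝ≥0) (A : Set Ω) (B : Set α),
    MeasurableSet[⨆ u : Set.Iic s, MeasurableSpace.comap (X u) inferInstance] A →
    MeasurableSet B →
    P (A ∩ X (s + t) ⁻¹' B) = ∫⁻ ω in A, p t (X s ω) B ∂P
  backward : ∀ (s : ℝ) (t : ℝ≥0) (A : Set Ω) (B : Set α),
    MeasurableSet[⨆ u : Set.Ici s, MeasurableSpace.comap (X u) inferInstance] A →
    MeasurableSet B →
    P (A ∩ X (s - t) ⁻¹' B) = ∫⁻ ω in A, q t (X s ω) B ∂P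

/-- `μ` is an invariant measure of the process `X` (with transition functions `p`, `q`):
`μ B = ∫ p t x B μ(dx) = ∫ q t x B μ(dx)`. Either the process is a proper one, carried by a
probability measure (not necessarily stationary), and then its transition functions, which are
conditional probabilities given `X s` and hence only determined up to null sets of the law of `X s`,
have to be determined `μ`-almost everywhere; or it is an improper one, that is stationary with the
(possibly infinite) measure `μ` as its one-time marginal. -/
structure IsInvariantMeasure (P : Measure Ω) (X : ℝ → Ω → α) (p q : ℝ≥0 → Kernel α α)
    (μ : Measure α) : Prop where
  forward : ∀ t, (p t).Invariant μ
  backward : ∀ t, (q t).Invariant μ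
  proper_or_improper :
    (IsProbabilityMeasure P ∧ ∀ s, μ ≪ P.map (X s)) ∨ (∀ s, P.map (X s) = μ)

end MarkovProcess

/-! ### The semigroups and their generators -/

section Semigroup

variable {α : Type*} [MeasurableSpace α]

theorem enorm_integral_sq_le {m : Measure α} [IsProbabilityMeasure m] {f : α → ℂ}
    (hf : StronglyMeasurable f) : ‖∫ y, f y ∂m‖ₑ ^ 2 ≤ ∫⁻ y, ‖f y‖ₑ ^ 2 ∂m := by
  have h1 : ‖∫ y, f y ∂m‖ₑ ≤ eLpNorm f 2 m := by
    refine (enorm_integral_le_lintegral_enorm f).trans ?_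
    rw [← eLpNorm_one_eq_lintegral_enorm]
    exact eLpNorm_le_eLpNorm_of_exponent_le (by norm_num) hf.aestronglyMeasurable
  calc ‖∫ y, f y ∂m‖ₑ ^ 2 ≤ eLpNorm f 2 m ^ 2 := by gcongr
    _ = ∫⁻ y, ‖f y‖ₑ ^ 2 ∂m := by
      have := eLpNorm_nnreal_pow_eq_lintegral (f := f) (μ := m) (p := 2) (by norm_num)
      simpa using this

theorem memLp_two_iff_lintegral {m : Measure α} {f : α → ℂ} (hf : AEStronglyMeasurable f m) :
    MemLp f 2 m ↔ ∫⁻ y, ‖f y‖ₑ ^ 2 ∂m < ∞ := by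
  have := eLpNorm_nnreal_pow_eq_lintegral (f := f) (μ := m) (p := 2) (by norm_num)
  have h2 : eLpNorm f 2 m ^ 2 = ∫⁻ y, ‖f y‖ₑ ^ 2 ∂m := by simpa using this
  rw [← h2]
  simp [MemLp, hf]

variable (κ : Kernel α α) (μ : Measure α)

theorem lintegral_lintegral_of_invariant (h : κ.Invariant μ) {g : α → ℝ≥0∞} (hg : Measurable g) :
    ∫⁻ x, ∫⁻ y, g y ∂κ x ∂μ = ∫⁻ y, g y ∂μ := by
  rw [← Measure.lintegral_bind κ.aemeasurable (hg.aemeasurable), h.def]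

theorem memLp_kernel_integral [IsMarkovKernel κ] (h : κ.Invariant μ) (f : Lp ℂ 2 μ) :
    MemLp (fun x => ∫ y, f y ∂κ x) 2 μ := by
  have hf := Lp.stronglyMeasurable f
  rw [memLp_two_iff_lintegral hf.integral_kernel.aestronglyMeasurable]
  calc ∫⁻ x, ‖∫ y, f y ∂κ x‖ₑ ^ 2 ∂μ ≤ ∫⁻ x, ∫⁻ y, ‖f y‖ₑ ^ 2 ∂κ x ∂μ :=
        lintegral_mono fun x => enorm_integral_sq_le hf
    _ = ∫⁻ y, ‖f y‖ₑ ^ 2 ∂μ := lintegral_lintegral_of_invariant κ μ h (by fun_prop)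
    _ < ∞ := (memLp_two_iff_lintegral hf.aestronglyMeasurable).1 (Lp.memLp f)

theorem ae_integrable_kernel [IsMarkovKernel κ] (h : κ.Invariant μ) (f : Lp ℂ 2 μ) :
    ∀ᵐ x ∂μ, Integrable f (κ x) := by
  have hf := Lp.stronglyMeasurable f
  have h1 : ∫⁻ x, ∫⁻ y, ‖f y‖ₑ ^ 2 ∂κ x ∂μ ≠ ∞ := by
    rw [lintegral_lintegral_of_invariant κ μ h (by fun_prop)]
    exact ((memLp_two_iff_lintegral hf.aestronglyMeasurable).1 (Lp.memLp f)).ne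
  have h2 : Measurable fun x => ∫⁻ y, ‖f y‖ₑ ^ 2 ∂κ x :=
    Measurable.lintegral_kernel (by fun_prop)
  filter_upwards [ae_lt_top h2 h1] with x hx
  exact ((memLp_two_iff_lintegral hf.aestronglyMeasurable).2 hx).integrable (by norm_num)

theorem ae_ae_of_invariant (h : κ.Invariant μ) {s : α → Prop} (hs : ∀ᵐ y ∂μ, s y) :
    ∀ᵐ x ∂μ, ∀ᵐ y ∂κ x, s y := by
  refine Measure.ae_ae_of_ae_comp ?_
  rwa [h.def]

/-- The operator `[T f](x) = ∫ f(y) κ(x, dy)` on the complex space `L²(μ)`, for a transition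
kernel `κ` that leaves `μ` invariant. -/
def transitionOp [IsMarkovKernel κ] (h : κ.Invariant μ) : Lp ℂ 2 μ →ₗ[ℂ] Lp ℂ 2 μ where
  toFun f := (memLp_kernel_integral κ μ h f).toLp _
  map_add' f g := by
    rw [← MemLp.toLp_add]
    refine MemLp.toLp_congr _ _ ?_
    filter_upwards [ae_integrable_kernel κ μ h f, ae_integrable_kernel κ μ h g,
      ae_ae_of_invariant κ μ h (Lp.coeFn_add f g)] with x hf hg hfg
    rw [integral_congr_ae hfg]
    exact integral_add hf hg
  map_smul' c f := by
    rw [RingHom.id_apply, ← MemLp.toLp_const_smul]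
    refine MemLp.toLp_congr _ _ ?_
    filter_upwards [ae_ae_of_invariant κ μ h (Lp.coeFn_smul c f)] with x hf
    rw [integral_congr_ae hf]
    exact integral_smul c _

end Semigroup

section Generator

variable {H : Type*} [NormedAddCommGroup H] [NormedSpace ℂ H]

/-- The graph of the infinitesimal generator of `(T_t)_{t ≥ 0}`: the pairs `(f, g)` with
`g = lim_{t ↓ 0} (T_t f - f) / t` in norm. -/
def generatorGraph (T : ℝ≥0 → H →ₗ[ℂ] H) : Submodule ℂ (H × H) where
  carrier := {z | Tendsto (fun t : ℝ≥0 => ((t : ℝ) : ℂ)⁻¹ • (T t z.1 - z.1)) (𝓝[>] 0) (𝓝 z.2)}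
  zero_mem' := by simp
  add_mem' {a b} ha hb := by
    refine (Tendsto.add ha hb).congr fun t => ?_
    simp only [Prod.fst_add, map_add]
    rw [← smul_add]
    congr 1
    abel
  smul_mem' c a ha := by
    refine (Tendsto.const_smul ha c).congr fun t => ?_
    simp only [Prod.smul_fst, map_smul]
    rw [smul_comm, smul_sub]

/-- The infinitesimal generator of `(T_t)_{t ≥ 0}`. -/
def generator (T : ℝ≥0 → H →ₗ[ℂ] H) : H →ₗ.[ℂ] H := (generatorGraph T).toLinearPMap

/-- The operator `A ↦ U A U⁻¹`, with domain `U D(A)`, for an isometry `U`. -/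
def transport {H' : Type*} [NormedAddCommGroup H'] [NormedSpace ℂ H'] (U : H →ₗᵢ[ℂ] H')
    (A : H →ₗ.[ℂ] H) : H' →ₗ.[ℂ] H' :=
  (A.graph.map (U.toLinearMap.prodMap U.toLinearMap)).toLinearPMap

/-- The identity operator, defined on the whole space. -/
def idOp (H : Type*) [NormedAddCommGroup H] [NormedSpace ℂ H] : H →ₗ.[ℂ] H :=
  (LinearMap.id : H →ₗ[ℂ] H).toPMap ⊤

/-- The combination `-(L̃ + i L) / (i + 1)` of a forward and a backward generator, defined on
`D(L) ∩ D(L̃)`. -/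
def symmetrize (L L' : H →ₗ.[ℂ] H) : H →ₗ.[ℂ] H :=
  -((Complex.I + 1)⁻¹ • (L' + Complex.I • L))

end Generator

section MarkovGenerator

variable {α : Type*} [MeasurableSpace α]

/-- The generator in the complex space `L²(μ)` of the semigroup with transition functions `p t`. -/
def markovGenerator (p : ℝ≥0 → Kernel α α) [∀ t, IsMarkovKernel (p t)] (μ : Measure α)
    (h : ∀ t, (p t).Invariant μ) : Lp ℂ 2 μ →ₗ.[ℂ] Lp ℂ 2 μ :=
  generator fun t => transitionOp (p t) μ (h t)

/-- The transition kernel `(x, s) ↦ κ(x, ·) ⊗ δ_{s + r}` on the space-time `α × ℝ`. -/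
def spaceTimeKernel (κ : Kernel α α) (r : ℝ) : Kernel (α × ℝ) (α × ℝ) :=
  κ ∥ₖ Kernel.deterministic (fun s : ℝ => s + r) (by fun_prop)

instance (κ : Kernel α α) [IsMarkovKernel κ] (r : ℝ) : IsMarkovKernel (spaceTimeKernel κ r) := by
  unfold spaceTimeKernel; infer_instance

theorem spaceTimeKernel_invariant {κ : Kernel α α} [IsMarkovKernel κ] {μ : Measure α} [SFinite μ]
    (h : κ.Invariant μ) (r : ℝ) : (spaceTimeKernel κ r).Invariant (μ.prod volume) := by
  have h2 : (Kernel.deterministic (fun s : ℝ => s + r) (by fun_prop)).Invariant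
      (volume : Measure ℝ) := by
    rw [Kernel.Invariant, Measure.deterministic_comp_eq_map, map_add_right_eq_self]
  have e : spaceTimeKernel κ r = (Kernel.id ∥ₖ Kernel.deterministic (fun s : ℝ => s + r)
      (by fun_prop)) ∘ₖ (κ ∥ₖ Kernel.id) := by
    rw [Kernel.parallelComp_id_left_comp_parallelComp, Kernel.comp_id, spaceTimeKernel]
  rw [Kernel.Invariant, e, ← Measure.comp_assoc, ← Measure.prod_comp_left, h.def,
    ← Measure.prod_comp_right, h2.def]

end MarkovGenerator

/-! ### Functions of time, tensor products, multiplication operators -/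

/-- The derivative `∂_t` in `L²(ℝ, dt)`, defined on the space `H¹` of the (classes of) absolutely
continuous functions with a square integrable derivative, that is the indefinite integrals
`c + ∫₀ᵗ h` with `h` in `L²`; its graph consists of the pairs `(c + ∫₀ᵗ h, h)` in `L² × L²`. -/
def timeDerivGraph :
    Submodule ℂ (Lp ℂ 2 (volume : Measure ℝ) × Lp ℂ 2 (volume : Measure ℝ)) where
  carrier := {z | ∃ c : ℂ, ∀ᵐ t : ℝ, z.1 t = c + ∫ s in (0 : ℝ)..t, z.2 s}
  zero_mem' := by
    refine ⟨0, ?_⟩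
    have h0 := Lp.coeFn_zero ℂ 2 (volume : Measure ℝ)
    filter_upwards [h0] with t ht
    have : ∫ s in (0 : ℝ)..t, (0 : Lp ℂ 2 (volume : Measure ℝ)) s = 0 := by
      rw [intervalIntegral.integral_congr_ae (g := fun _ => 0)]
      · simp
      · filter_upwards [h0] with s hs _ using hs
    rw [Prod.fst_zero, Prod.snd_zero, ht, this]
    simp
  add_mem' {a b} := by
    rintro ⟨c, hc⟩ ⟨d, hd⟩
    refine ⟨c + d, ?_⟩
    have hi : ∀ (f : Lp ℂ 2 (volume : Measure ℝ)) (t : ℝ), IntervalIntegrable f volume 0 t :=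
      fun f t => (((Lp.memLp f).locallyIntegrable (by norm_num)).integrableOn_isCompact
        isCompact_uIcc).intervalIntegrable
    filter_upwards [hc, hd, Lp.coeFn_add a.1 b.1] with t h1 h2 h3
    have : ∫ s in (0 : ℝ)..t, (a.2 + b.2) s = ∫ s in (0 : ℝ)..t, (a.2 s + b.2 s) := by
      refine intervalIntegral.integral_congr_ae ?_
      filter_upwards [Lp.coeFn_add a.2 b.2] with s hs _ using hs
    rw [Prod.fst_add, Prod.snd_add, h3, this, intervalIntegral.integral_add (hi _ _) (hi _ _)]
    simp only [Pi.add_apply, h1, h2]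
    ring
  smul_mem' k a := by
    rintro ⟨c, hc⟩
    refine ⟨k * c, ?_⟩
    filter_upwards [hc, Lp.coeFn_smul k a.1] with t h1 h3
    have : ∫ s in (0 : ℝ)..t, (k • a.2) s = ∫ s in (0 : ℝ)..t, k * a.2 s := by
      refine intervalIntegral.integral_congr_ae ?_
      filter_upwards [Lp.coeFn_smul k a.2] with s hs _ using hs
    rw [Prod.smul_fst, Prod.smul_snd, h3, this, intervalIntegral.integral_const_mul]
    simp only [Pi.smul_apply, h1, smul_eq_mul]
    ring

/-- The derivative `∂_t` as an unbounded operator in `L²(ℝ, dt)`, with domain `H¹`. -/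
def timeDeriv : Lp ℂ 2 (volume : Measure ℝ) →ₗ.[ℂ] Lp ℂ 2 (volume : Measure ℝ) :=
  timeDerivGraph.toLinearPMap

section Tensor

variable {α β : Type*} [MeasurableSpace α] [MeasurableSpace β]
  {μ : Measure α} {ν : Measure β} [SFinite ν]

theorem memLp_tensor (f : Lp ℂ 2 μ) (g : Lp ℂ 2 ν) :
    MemLp (fun z : α × β => f z.1 * g z.2) 2 (μ.prod ν) := by
  have hf := Lp.stronglyMeasurable f
  have hg := Lp.stronglyMeasurable g
  have hm : StronglyMeasurable fun z : α × β => f z.1 * g z.2 :=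
    (hf.comp_measurable measurable_fst).mul (hg.comp_measurable measurable_snd)
  rw [memLp_two_iff_lintegral hm.aestronglyMeasurable]
  have : ∀ z : α × β, ‖f z.1 * g z.2‖ₑ ^ 2 = ‖f z.1‖ₑ ^ 2 * ‖g z.2‖ₑ ^ 2 := fun z => by
    rw [enorm_mul, mul_pow]
  simp_rw [this]
  rw [lintegral_prod_mul (f := fun x => ‖f x‖ₑ ^ 2) (g := fun y => ‖g y‖ₑ ^ 2)
    (by fun_prop) (by fun_prop)]
  exact ENNReal.mul_lt_top ((memLp_two_iff_lintegral hf.aestronglyMeasurable).1 (Lp.memLp f))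
    ((memLp_two_iff_lintegral hg.aestronglyMeasurable).1 (Lp.memLp g))

/-- The product function `(x, t) ↦ f(x) g(t)` in `L²(μ ⊗ ν)`. -/
def tensorLp (f : Lp ℂ 2 μ) (g : Lp ℂ 2 ν) : Lp ℂ 2 (μ.prod ν) := (memLp_tensor f g).toLp _

/-- The (algebraic) tensor product of two subspaces, as a subspace of `L²(μ ⊗ ν)`. -/
def tensorSubmodule (V : Submodule ℂ (Lp ℂ 2 μ)) (W : Submodule ℂ (Lp ℂ 2 ν)) :
    Submodule ℂ (Lp ℂ 2 (μ.prod ν)) :=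
  Submodule.span ℂ {F | ∃ f ∈ V, ∃ g ∈ W, F = tensorLp f g}

/-- The tensor product `A ⊗ B` of two operators: it is the linear operator with domain
`D(A) ⊗ D(B)` that maps `f ⊗ g` to `A f ⊗ B g`. -/
def tensorOp (A : Lp ℂ 2 μ →ₗ.[ℂ] Lp ℂ 2 μ) (B : Lp ℂ 2 ν →ₗ.[ℂ] Lp ℂ 2 ν) :
    Lp ℂ 2 (μ.prod ν) →ₗ.[ℂ] Lp ℂ 2 (μ.prod ν) :=
  (Submodule.span ℂ (Set.range fun z : A.domain × B.domain =>
    (tensorLp (z.1 : Lp ℂ 2 μ) (z.2 : Lp ℂ 2 ν), tensorLp (A z.1) (B z.2)))).toLinearPMap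

end Tensor

section Multiplication

variable {α : Type*} [MeasurableSpace α] {ν μ : Measure α} {w : α → ℂ}

theorem lintegral_mul_weight (hw : Measurable w) (h : μ = ν.withDensity fun x => ‖w x‖ₑ ^ 2)
    (f : Lp ℂ 2 μ) : ∫⁻ x, ‖f x * w x‖ₑ ^ 2 ∂ν = ∫⁻ x, ‖f x‖ₑ ^ 2 ∂μ := by
  have hf := Lp.stronglyMeasurable f
  have key : ∀ g : α → ℂ, StronglyMeasurable g →
      ∫⁻ x, ‖g x‖ₑ ^ 2 ∂μ = ∫⁻ x, ((fun x => ‖w x‖ₑ ^ 2) * fun x => ‖g x‖ₑ ^ 2) x ∂ν := by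
    intro g hg
    rw [h, lintegral_withDensity_eq_lintegral_mul _ (by fun_prop) (by fun_prop)]
  rw [key f hf]
  refine lintegral_congr fun x => ?_
  rw [Pi.mul_apply, enorm_mul, mul_pow, mul_comm]

theorem memLp_mul_weight (hw : Measurable w) (h : μ = ν.withDensity fun x => ‖w x‖ₑ ^ 2)
    (f : Lp ℂ 2 μ) : MemLp (fun x => f x * w x) 2 ν := by
  have hf := Lp.stronglyMeasurable f
  have hm : StronglyMeasurable fun x => f x * w x := hf.mul hw.stronglyMeasurable
  rw [memLp_two_iff_lintegral hm.aestronglyMeasurable, lintegral_mul_weight hw h]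
  exact (memLp_two_iff_lintegral hf.aestronglyMeasurable).1 (Lp.memLp f)

theorem ae_weight (hw : Measurable w) (h : μ = ν.withDensity fun x => ‖w x‖ₑ ^ 2)
    {u v : α → ℂ} (huv : u =ᵐ[μ] v) : (fun x => u x * w x) =ᵐ[ν] fun x => v x * w x := by
  rw [h, Filter.EventuallyEq, ae_withDensity_iff (by fun_prop)] at huv
  filter_upwards [huv] with x hx
  by_cases h0 : w x = 0
  · simp [h0]
  · rw [hx (by simpa using h0)]

/-- The isometry `f ↦ f w` from `L²(|w|² dν)` to `L²(dν)`. It is onto (hence unitary, with inverse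
the multiplication by `1 / w`) as soon as `w` does not vanish `ν`-almost everywhere. -/
def mulIsometry (hw : Measurable w) (h : μ = ν.withDensity fun x => ‖w x‖ₑ ^ 2) :
    Lp ℂ 2 μ →ₗᵢ[ℂ] Lp ℂ 2 ν where
  toFun f := (memLp_mul_weight hw h f).toLp _
  map_add' f g := by
    rw [← MemLp.toLp_add]
    refine MemLp.toLp_congr _ _ ?_
    filter_upwards [ae_weight hw h (Lp.coeFn_add f g)] with x hx
    rw [hx]
    simp [add_mul]
  map_smul' c f := by
    rw [RingHom.id_apply, ← MemLp.toLp_const_smul]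
    refine MemLp.toLp_congr _ _ ?_
    filter_upwards [ae_weight hw h (Lp.coeFn_smul c f)] with x hx
    rw [hx]
    simp [mul_assoc]
  norm_map' f := by
    have key : eLpNorm (fun x => f x * w x) 2 ν = eLpNorm f 2 μ := by
      have h1 := eLpNorm_nnreal_pow_eq_lintegral (f := fun x => f x * w x) (μ := ν) (p := 2)
        (by norm_num)
      have h2 := eLpNorm_nnreal_pow_eq_lintegral (f := f) (μ := μ) (p := 2) (by norm_num)
      have h3 : eLpNorm (fun x => f x * w x) 2 ν ^ 2 = eLpNorm f 2 μ ^ 2 := by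
        have h1' : eLpNorm (fun x => f x * w x) 2 ν ^ 2 = ∫⁻ x, ‖f x * w x‖ₑ ^ 2 ∂ν := by
          simpa using h1
        have h2' : eLpNorm f 2 μ ^ 2 = ∫⁻ x, ‖f x‖ₑ ^ 2 ∂μ := by simpa using h2
        rw [h1', h2', lintegral_mul_weight hw h]
      exact (ENNReal.pow_right_strictMono (n := 2) (by norm_num)).injective h3
    change ‖(memLp_mul_weight hw h f).toLp _‖ = ‖f‖
    rw [Lp.norm_toLp, key, Lp.norm_def]

end Multiplication

/-! ### Semibounded symmetric operators and their Friedrichs extension -/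

section Friedrichs

variable {H : Type*} [NormedAddCommGroup H] [InnerProductSpace ℂ H]

/-- `⟨u, A u⟩ ≥ c ‖u‖²` on the domain of `A`, for some real `c`. -/
def IsBoundedBelow (A : H →ₗ.[ℂ] H) : Prop :=
  ∃ c : ℝ, ∀ u : A.domain, c * ‖(u : H)‖ ^ 2 ≤ (inner ℂ (u : H) (A u)).re

/-- Densely defined, symmetric, and bounded from below. -/
structure IsSymmetricSemibounded (A : H →ₗ.[ℂ] H) : Prop where
  dense : Dense (A.domain : Set H)
  symmetric : A.IsFormalAdjoint A
  boundedBelow : IsBoundedBelow A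

theorem form_add_le {A : H →ₗ.[ℂ] H} {c : ℝ}
    (hc : ∀ u : A.domain, c * ‖(u : H)‖ ^ 2 ≤ (inner ℂ (u : H) (A u)).re) (u v : A.domain) :
    (inner ℂ ((u + v : A.domain) : H) (A (u + v))).re ≤
      2 * (inner ℂ (u : H) (A u)).re + 2 * (inner ℂ (v : H) (A v)).re
        - c * ‖((u - v : A.domain) : H)‖ ^ 2 := by
  have h := hc (u - v)
  have e : (inner ℂ ((u + v : A.domain) : H) (A (u + v))).re
      + (inner ℂ ((u - v : A.domain) : H) (A (u - v))).re
      = 2 * (inner ℂ (u : H) (A u)).re + 2 * (inner ℂ (v : H) (A v)).re := by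
    rw [LinearPMap.map_add, LinearPMap.map_sub]
    simp only [Submodule.coe_add, Submodule.coe_sub, inner_add_left, inner_add_right,
      inner_sub_left, inner_sub_right, Complex.add_re, Complex.sub_re]
    ring
  linarith

/-- The form domain of `A`: the completion, inside `H`, of `D(A)` for the norm
`‖u‖² + ⟨u, A u⟩ + const ‖u‖²`, that is the limits in `H` of the sequences `u_n` in `D(A)` with
`⟨u_m - u_n, A (u_m - u_n)⟩ → 0` as `m, n → ∞`. -/
def formDomain (A : H →ₗ.[ℂ] H) (hA : IsBoundedBelow A) : Submodule ℂ H where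
  carrier := {x | ∃ u : ℕ → A.domain, Tendsto (fun n => (u n : H)) atTop (𝓝 x) ∧
    Tendsto (fun k : ℕ × ℕ => (inner ℂ ((u k.1 - u k.2 : A.domain) : H)
      (A (u k.1 - u k.2))).re) atTop (𝓝 0)}
  zero_mem' := ⟨fun _ => 0, by simp, by simp⟩
  add_mem' {x y} := by
    rintro ⟨u, hu, hu'⟩ ⟨v, hv, hv'⟩
    obtain ⟨c, hc⟩ := hA
    refine ⟨fun n => u n + v n, by simpa using hu.add hv, ?_⟩
    have hsub : ∀ {z : H} {w : ℕ → H}, Tendsto w atTop (𝓝 z) →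
        Tendsto (fun k : ℕ × ℕ => w k.1 - w k.2) atTop (𝓝 0) := fun {z w} hw => by
      have h1 : Tendsto (fun k : ℕ × ℕ => w k.1) atTop (𝓝 z) := by
        rw [← prod_atTop_atTop_eq]; exact hw.comp tendsto_fst
      have h2 : Tendsto (fun k : ℕ × ℕ => w k.2) atTop (𝓝 z) := by
        rw [← prod_atTop_atTop_eq]; exact hw.comp tendsto_snd
      simpa using h1.sub h2
    have hu2 := hsub hu
    have hv2 := hsub hv
    have hlow : Tendsto (fun k : ℕ × ℕ => c * ‖((u k.1 : H) - u k.2) + ((v k.1 : H) - v k.2)‖ ^ 2)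
        atTop (𝓝 0) := by
      simpa using (((hu2.add hv2).norm.pow 2).const_mul c)
    have hup : Tendsto (fun k : ℕ × ℕ =>
        2 * (inner ℂ ((u k.1 - u k.2 : A.domain) : H) (A (u k.1 - u k.2))).re
        + 2 * (inner ℂ ((v k.1 - v k.2 : A.domain) : H) (A (v k.1 - v k.2))).re
        - c * ‖((u k.1 : H) - u k.2) - ((v k.1 : H) - v k.2)‖ ^ 2) atTop (𝓝 0) := by
      simpa using ((hu'.const_mul 2).add (hv'.const_mul 2)).sub
        (((hu2.sub hv2).norm.pow 2).const_mul c)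
    have e : ∀ k : ℕ × ℕ, (u k.1 + v k.1) - (u k.2 + v k.2)
        = (u k.1 - u k.2) + (v k.1 - v k.2) := fun k => by abel
    refine tendsto_of_tendsto_of_tendsto_of_le_of_le hlow hup (fun k => ?_) (fun k => ?_)
    · have := hc ((u k.1 - u k.2) + (v k.1 - v k.2))
      simp only [e]
      simpa using this
    · have := form_add_le hc (u k.1 - u k.2) (v k.1 - v k.2)
      simp only [e]
      simpa using this
  smul_mem' a x := by
    rintro ⟨u, hu, hu'⟩
    refine ⟨fun n => a • u n, by simpa using hu.const_smul a, ?_⟩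
    have : Tendsto (fun k : ℕ × ℕ => ‖a‖ ^ 2 *
        (inner ℂ ((u k.1 - u k.2 : A.domain) : H) (A (u k.1 - u k.2))).re) atTop (𝓝 0) := by
      simpa using hu'.const_mul (‖a‖ ^ 2)
    refine this.congr fun k => ?_
    rw [← smul_sub, LinearPMap.map_smul, Submodule.coe_smul, inner_smul_left, inner_smul_right,
      ← mul_assoc, Complex.conj_mul', ← Complex.ofReal_pow, Complex.re_ofReal_mul]

/-- The Friedrichs extension of a symmetric, bounded from below operator `A`: the restriction of
the adjoint of `A` to the form domain of `A`. -/
def friedrichs [CompleteSpace H] (A : H →ₗ.[ℂ] H) (hA : IsSymmetricSemibounded A) :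
    H →ₗ.[ℂ] H :=
  A.adjoint.domRestrict (formDomain A hA.boundedBelow)

end Friedrichs

/-! ### The wave functions, the Doob transformation and the Hamiltonian -/

/-- The state space `ℝⁿ`. -/
abbrev Space (n : ℕ) : Type := EuclideanSpace ℝ (Fin n)

variable {n : ℕ}

/-- The absolutely continuous measure `ρ(x) dx`. -/
def densityMeasure (ρ : Space n → ℝ) : Measure (Space n) :=
  volume.withDensity fun x => ENNReal.ofReal (ρ x)

instance (ρ : Space n → ℝ) : SigmaFinite (densityMeasure ρ) := by
  unfold densityMeasure; infer_instance

/-- `ψ(x) = √ρ(x) e^{i S(x)}`. -/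
def waveψ (ρ S : Space n → ℝ) (x : Space n) : ℂ :=
  (Real.sqrt (ρ x) : ℂ) * Complex.exp (Complex.I * (S x : ℂ))

/-- `Ψ(x, t) = ψ(x) e^{-i E t}`. -/
def waveΨ (ρ S : Space n → ℝ) (E : ℝ) (z : Space n × ℝ) : ℂ :=
  waveψ ρ S z.1 * Complex.exp (-(Complex.I * (E : ℂ) * (z.2 : ℂ)))

theorem measurable_waveψ {ρ S : Space n → ℝ} (hρ : Measurable ρ) (hS : Measurable S) :
    Measurable (waveψ ρ S) := by
  unfold waveψ; fun_prop

theorem measurable_waveΨ {ρ S : Space n → ℝ} (hρ : Measurable ρ) (hS : Measurable S) (E : ℝ) :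
    Measurable (waveΨ ρ S E) := by
  have := measurable_waveψ hρ hS
  unfold waveΨ; fun_prop

theorem enorm_waveψ_sq (ρ S : Space n → ℝ) (x : Space n) :
    ‖waveψ ρ S x‖ₑ ^ 2 = ENNReal.ofReal (ρ x) := by
  have h1 : ‖waveψ ρ S x‖ = Real.sqrt (ρ x) := by
    rw [waveψ, norm_mul, mul_comm Complex.I, Complex.norm_exp_ofReal_mul_I, mul_one,
      Complex.norm_real, Real.norm_of_nonneg (Real.sqrt_nonneg _)]
  rw [← ofReal_norm, h1, ← ENNReal.ofReal_pow (Real.sqrt_nonneg _)]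
  rcases le_total 0 (ρ x) with h | h
  · rw [Real.sq_sqrt h]
  · rw [Real.sqrt_eq_zero_of_nonpos h, ENNReal.ofReal_of_nonpos h]
    simp

theorem enorm_waveΨ_sq (ρ S : Space n → ℝ) (E : ℝ) (z : Space n × ℝ) :
    ‖waveΨ ρ S E z‖ₑ ^ 2 = ENNReal.ofReal (ρ z.1) := by
  have h1 : ‖Complex.exp (-(Complex.I * (E : ℂ) * (z.2 : ℂ)))‖ = 1 := by
    have : -(Complex.I * (E : ℂ) * (z.2 : ℂ)) = ((-(E * z.2) : ℝ) : ℂ) * Complex.I := by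
      push_cast; ring
    rw [this, Complex.norm_exp_ofReal_mul_I]
  have h2 : ‖Complex.exp (-(Complex.I * (E : ℂ) * (z.2 : ℂ)))‖ₑ = 1 := by
    rw [← ofReal_norm, h1, ENNReal.ofReal_one]
  rw [waveΨ, enorm_mul, h2, mul_one, enorm_waveψ_sq]

theorem density_eq_ψ (ρ S : Space n → ℝ) :
    densityMeasure ρ = volume.withDensity fun x => ‖waveψ ρ S x‖ₑ ^ 2 := by
  simp_rw [enorm_waveψ_sq]; rfl

theorem density_eq_Ψ {ρ : Space n → ℝ} (hρ : Measurable ρ) (S : Space n → ℝ) (E : ℝ) :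
    (densityMeasure ρ).prod (volume : Measure ℝ) =
      ((volume : Measure (Space n)).prod (volume : Measure ℝ)).withDensity
        fun z => ‖waveΨ ρ S E z‖ₑ ^ 2 := by
  simp_rw [enorm_waveΨ_sq]
  exact prod_withDensity_left (by fun_prop)

section Hamiltonian

variable (p q : ℝ≥0 → Kernel (Space n) (Space n))
  [∀ t, IsMarkovKernel (p t)] [∀ t, IsMarkovKernel (q t)]

/-- The forward generator `L^Y` of the space-time process `Y_t = (X_t, t)`, with domain
`D(L) ⊗ H¹`. The semigroup of `Y` is `(x, s) ↦ ∫ f(y, s + t) p t x (dy)`. -/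
def spaceTimeForward (μ : Measure (Space n)) [SFinite μ] (hp : ∀ t, (p t).Invariant μ) :
    Lp ℂ 2 (μ.prod (volume : Measure ℝ)) →ₗ.[ℂ] Lp ℂ 2 (μ.prod (volume : Measure ℝ)) :=
  (markovGenerator (fun t => spaceTimeKernel (p t) t) (μ.prod volume)
      fun t => spaceTimeKernel_invariant (hp t) t).domRestrict
    (tensorSubmodule (markovGenerator p μ hp).domain timeDeriv.domain)

/-- The backward generator of the space-time process `Y_t = (X_t, t)`, with domain `D(L̃) ⊗ H¹`.
The backward semigroup of `Y` is `(x, s) ↦ ∫ f(y, s - t) q t x (dy)`. -/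
def spaceTimeBackward (μ : Measure (Space n)) [SFinite μ] (hq : ∀ t, (q t).Invariant μ) :
    Lp ℂ 2 (μ.prod (volume : Measure ℝ)) →ₗ.[ℂ] Lp ℂ 2 (μ.prod (volume : Measure ℝ)) :=
  (markovGenerator (fun t => spaceTimeKernel (q t) (-t)) (μ.prod volume)
      fun t => spaceTimeKernel_invariant (hq t) (-t)).domRestrict
    (tensorSubmodule (markovGenerator q μ hq).domain timeDeriv.domain)

variable {ρ S : Space n → ℝ} (hρ : Measurable ρ) (hS : Measurable S) (E : ℝ)
  (hp : ∀ t, (p t).Invariant (densityMeasure ρ)) (hq : ∀ t, (q t).Invariant (densityMeasure ρ))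

/-- The Doob transform `K^Y_Ψ = U_Ψ K^Y U_Ψ⁻¹` of the symmetrized space-time operator
`K^Y = -(L̃^Y + i L^Y) / (i + 1)`. -/
def doobSpaceTime :
    Lp ℂ 2 ((volume : Measure (Space n)).prod (volume : Measure ℝ)) →ₗ.[ℂ]
      Lp ℂ 2 ((volume : Measure (Space n)).prod (volume : Measure ℝ)) :=
  transport (mulIsometry (measurable_waveΨ hρ hS E) (density_eq_Ψ hρ S E))
    (symmetrize (spaceTimeForward p (densityMeasure ρ) hp)
      (spaceTimeBackward q (densityMeasure ρ) hq))

/-- The Doob transform `K_ψ = U_ψ K U_ψ⁻¹` of the reduced operator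
`K = -(L̃ + i L) / (i + 1)`. -/
def doobReduced :
    Lp ℂ 2 (volume : Measure (Space n)) →ₗ.[ℂ] Lp ℂ 2 (volume : Measure (Space n)) :=
  transport (mulIsometry (measurable_waveψ hρ hS) (density_eq_ψ ρ S))
    (symmetrize (markovGenerator p (densityMeasure ρ) hp)
      (markovGenerator q (densityMeasure ρ) hq))

/-- `H₀ = K_ψ + E`. -/
def hamiltonian₀ :
    Lp ℂ 2 (volume : Measure (Space n)) →ₗ.[ℂ] Lp ℂ 2 (volume : Measure (Space n)) :=
  doobReduced p q hρ hS hp hq + (E : ℂ) • idOp (Lp ℂ 2 (volume : Measure (Space n)))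

end Hamiltonian

end DoobSchrodinger

end

noncomputable section

namespace DoobSchrodinger

/-! ### Graphs of partially defined operators -/

section Graphs

variable {H H' : Type*} [NormedAddCommGroup H] [NormedSpace ℂ H]
  [NormedAddCommGroup H'] [NormedSpace ℂ H']

/-! Everything rests on one duality: the backward transition operators are the adjoints of the
forward ones in `L²(μ)`. For an improper process this is read off from the law of `(X_0, X_t)`,
which is `μ ⊗ p_t` in one order of the coordinates and `μ ⊗ q_t` in the other. For a proper process
with one-time laws `ν_s`, that law `J` carries the two measures as densities `u(x) J` and `v(y) J`,
where `u = dμ/dν_0` and `v = dμ/dν_t`. Invariance makes all their marginals equal to `μ`, and a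
monotonicity argument (`density_eq_of_marginals`) then forces `u(x) = v(y)` almost everywhere, which
gives `compProd_map_swap`.

Hence `L̃` and `L` are formal adjoints. Since `1/(1+i) = (1-i)/2`, one has `K = -((1-i) L̃ + (1+i)
L)/2`, with conjugate coefficients. So `K` is symmetric, and its quadratic form is `-Re⟨φ, Lφ⟩ +
Im⟨φ, Lφ⟩`, the quantity bounded in hypothesis 4. Unitary transport and the shift by `E` preserve
both properties.

For the Friedrichs extension, `D(A)` is completed for the shifted form, and the inclusion extends to
a map `j` from the completion to `H`. The operator `j j†` is bounded, symmetric and inverts the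
shifted extension (`exists_friedrichs_resolvent`); an operator with such a resolvent is self-adjoint
(`isSelfAdjoint_of_resolvent`).

On product functions the space-time generators give `Lf ⊗ g + f ⊗ g'` and `L̃f ⊗ g - f ⊗ g'`. As
`(i-1)/(i+1) = i`, their combination is `Kf ⊗ g - i f ⊗ g'`. Multiplication by `Ψ` factors into
multiplication by `ψ` and by `e^{-iEt}`, and conjugating `-i∂_t` by the phase yields `-i∂_t + E`.
The domains agree because intersections of algebraic tensor products are computed factorwise
(`tensorSubmodule_inf`) and the phase preserves `H¹`.

Finally, if `μ` is finite, the constant `1` is fixed by both semigroups, so `K 1 = 0` and `ψ = U_ψ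
1` satisfies `H₀ψ = Eψ`. The time evolution only multiplies it by a scalar phase. -/

theorem mem_graph_add {A B : H →ₗ.[ℂ] H} {x y z : H} (hA : (x, y) ∈ A.graph)
    (hB : (x, z) ∈ B.graph) : (x, y + z) ∈ (A + B).graph := by
  rw [LinearPMap.mem_graph_iff] at *
  obtain ⟨a, rfl, rfl⟩ := hA
  obtain ⟨b, hb, rfl⟩ := hB
  refine ⟨⟨a, a.2, (show (b : H) = a from hb) ▸ b.2⟩, rfl, ?_⟩
  rw [LinearPMap.add_apply]
  congr 2
  exact Subtype.ext hb.symm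

theorem mem_graph_smul {A : H →ₗ.[ℂ] H} {x y : H} (c : ℂ) (hA : (x, y) ∈ A.graph) :
    (x, c • y) ∈ (c • A).graph := by
  rw [LinearPMap.mem_graph_iff] at *
  obtain ⟨a, rfl, rfl⟩ := hA
  exact ⟨a, rfl, rfl⟩

theorem mem_graph_neg {A : H →ₗ.[ℂ] H} {x y : H} (hA : (x, y) ∈ A.graph) :
    (x, -y) ∈ (-A).graph := by
  rw [LinearPMap.mem_graph_iff] at *
  obtain ⟨a, rfl, rfl⟩ := hA
  exact ⟨a, rfl, rfl⟩

theorem mem_graph_sub {A B : H →ₗ.[ℂ] H} {x y z : H} (hA : (x, y) ∈ A.graph)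
    (hB : (x, z) ∈ B.graph) : (x, y - z) ∈ (A - B).graph := by
  rw [LinearPMap.mem_graph_iff] at *
  obtain ⟨a, rfl, rfl⟩ := hA
  obtain ⟨b, hb, rfl⟩ := hB
  refine ⟨⟨a, a.2, (show (b : H) = a from hb) ▸ b.2⟩, rfl, ?_⟩
  rw [LinearPMap.sub_apply]
  congr 2
  exact Subtype.ext hb.symm

theorem mem_graph_idOp (x : H) : (x, x) ∈ (idOp H).graph :=
  (LinearPMap.mem_graph_iff _).2 ⟨⟨x, trivial⟩, rfl, rfl⟩

theorem mem_graph_symmetrize {A B : H →ₗ.[ℂ] H} {x y z : H} (hA : (x, y) ∈ A.graph)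
    (hB : (x, z) ∈ B.graph) :
    (x, -((Complex.I + 1)⁻¹ • (z + Complex.I • y))) ∈ (symmetrize A B).graph :=
  mem_graph_neg (mem_graph_smul _ (mem_graph_add hB (mem_graph_smul _ hA)))

theorem symmetrize_domain (A B : H →ₗ.[ℂ] H) :
    (symmetrize A B).domain = A.domain ⊓ B.domain :=
  inf_comm _ _

theorem mem_graph_domRestrict {A : H →ₗ.[ℂ] H} {V : Submodule ℂ H} {x y : H}
    (hx : x ∈ V) (hA : (x, y) ∈ A.graph) : (x, y) ∈ (A.domRestrict V).graph := by
  rw [LinearPMap.mem_graph_iff] at *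
  obtain ⟨a, rfl, rfl⟩ := hA
  exact ⟨⟨a, hx, a.2⟩, rfl, LinearPMap.domRestrict_apply rfl⟩

/-- `toLinearPMap` returns an operator with the prescribed graph only if that graph is
single-valued; here this follows from the injectivity of `U`. -/
theorem graph_transport (U : H →ₗᵢ[ℂ] H') (A : H →ₗ.[ℂ] H) :
    (transport U A).graph = A.graph.map (U.toLinearMap.prodMap U.toLinearMap) := by
  refine Submodule.toLinearPMap_graph_eq _ ?_
  rintro _ ⟨⟨x, y⟩, hxy, rfl⟩ h0
  have hx : x = 0 := U.injective (by simpa using h0)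
  have hy : y = 0 := A.graph_fst_eq_zero_snd hxy hx
  simp [hy]

theorem mem_graph_transport {U : H →ₗᵢ[ℂ] H'} {A : H →ₗ.[ℂ] H} {x y : H}
    (h : (x, y) ∈ A.graph) : (U x, U y) ∈ (transport U A).graph := by
  rw [graph_transport]
  exact ⟨(x, y), h, rfl⟩

theorem exists_of_mem_graph_transport {U : H →ₗᵢ[ℂ] H'} {A : H →ₗ.[ℂ] H} {x y : H'}
    (h : (x, y) ∈ (transport U A).graph) : ∃ a b, (a, b) ∈ A.graph ∧ U a = x ∧ U b = y := by
  rw [graph_transport] at h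
  obtain ⟨⟨a, b⟩, hab, h⟩ := h
  exact ⟨a, b, hab, congrArg Prod.fst h, congrArg Prod.snd h⟩

theorem transport_domain (U : H →ₗᵢ[ℂ] H') (A : H →ₗ.[ℂ] H) :
    (transport U A).domain = A.domain.map U.toLinearMap := by
  ext x
  rw [LinearPMap.mem_domain_iff]
  constructor
  · rintro ⟨y, hy⟩
    obtain ⟨a, b, hab, rfl, rfl⟩ := exists_of_mem_graph_transport hy
    exact ⟨a, LinearPMap.mem_domain_of_mem_graph hab, rfl⟩
  · rintro ⟨a, ha, rfl⟩
    exact ⟨U (A ⟨a, ha⟩), mem_graph_transport (A.mem_graph ⟨a, ha⟩)⟩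

/-- The vectors on which two operators are both defined and agree form a subspace, so a spanning set
is enough. This reduces the space-time identity to product functions. -/
theorem le_of_span {A B : H →ₗ.[ℂ] H} {s : Set H} (hA : A.domain ≤ Submodule.span ℂ s)
    (h : ∀ x ∈ s, ∃ y, (x, y) ∈ A.graph ∧ (x, y) ∈ B.graph) : A ≤ B := by
  refine LinearPMap.le_of_eqLocus_ge (hA.trans (Submodule.span_le.2 fun x hx => ?_))
  obtain ⟨y, hyA, hyB⟩ := h x hx
  obtain ⟨a, ha, hay⟩ := (LinearPMap.mem_graph_iff _).1 hyA
  obtain ⟨b, hb, hby⟩ := (LinearPMap.mem_graph_iff _).1 hyB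
  simp only at ha hb hay hby
  subst ha
  refine ⟨a.2, hb ▸ b.2, ?_⟩
  refine hay.trans (hby.symm.trans ?_)
  congr 1
  exact Subtype.ext hb

theorem eq_of_span {A B : H →ₗ.[ℂ] H} {s : Set H} (hA : A.domain ≤ Submodule.span ℂ s)
    (hB : B.domain ≤ Submodule.span ℂ s)
    (h : ∀ x ∈ s, ∃ y, (x, y) ∈ A.graph ∧ (x, y) ∈ B.graph) : A = B :=
  le_antisymm (le_of_span hA h) (le_of_span hB fun x hx => (h x hx).imp fun _ hy => hy.symm)

/-- Uniqueness of limits makes the graph single-valued, which `generator` needs in order to have the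
intended graph. -/
theorem generatorGraph_fst_eq_zero (T : ℝ≥0 → H →ₗ[ℂ] H) (z : H × H) (hz : z ∈ generatorGraph T)
    (h0 : z.1 = 0) : z.2 = 0 := by
  have h : Tendsto (fun t : ℝ≥0 => ((t : ℝ) : ℂ)⁻¹ • (T t z.1 - z.1)) (𝓝[>] 0) (𝓝 z.2) := hz
  simp only [h0, map_zero, sub_zero, smul_zero] at h
  exact tendsto_nhds_unique h tendsto_const_nhds

theorem mem_graph_generator {T : ℝ≥0 → H →ₗ[ℂ] H} {x y : H} :
    (x, y) ∈ (generator T).graph ↔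
      Tendsto (fun t : ℝ≥0 => ((t : ℝ) : ℂ)⁻¹ • (T t x - x)) (𝓝[>] 0) (𝓝 y) := by
  rw [generator, Submodule.toLinearPMap_graph_eq _ (generatorGraph_fst_eq_zero T)]
  rfl

/-- A vector that the semigroup fixes is in the kernel of the generator. -/
theorem mem_graph_generator_of_fixed {T : ℝ≥0 → H →ₗ[ℂ] H} {x : H} (h : ∀ t, T t x = x) :
    (x, 0) ∈ (generator T).graph := by
  rw [mem_graph_generator]
  simp [h]

end Graphs

/-! ### Formal adjoints and the symmetrized generator -/

section Duality

variable {H : Type*} [NormedAddCommGroup H] [InnerProductSpace ℂ H]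

/-- The generators of two semigroups in duality are formal adjoints of each other. -/
theorem generator_isFormalAdjoint {T T' : ℝ≥0 → H →ₗ[ℂ] H}
    (h : ∀ t x y, inner ℂ (T' t x) y = inner ℂ x (T t y)) :
    (generator T').IsFormalAdjoint (generator T) := by
  intro x y
  have hx := mem_graph_generator.1 ((generator T').mem_graph x)
  have hy := mem_graph_generator.1 ((generator T).mem_graph y)
  refine tendsto_nhds_unique (hx.inner tendsto_const_nhds)
    (Tendsto.congr (fun t => ?_) (tendsto_const_nhds.inner hy))
  simp [inner_smul_left, inner_smul_right, inner_sub_left, inner_sub_right, h]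

variable {L L' : H →ₗ.[ℂ] H}

theorem symmetrize_apply (x : (symmetrize L L').domain) :
    symmetrize L L' x = -((Complex.I + 1)⁻¹ • (L' ⟨x, x.2.1⟩ + Complex.I • L ⟨x, x.2.2⟩)) :=
  rfl

theorem inv_I_add_one : (Complex.I + 1)⁻¹ = (1 - Complex.I) / 2 := by
  have h : (Complex.I + 1) * ((1 - Complex.I) / 2) = 1 := by
    linear_combination (-1 / 2 : ℂ) * Complex.I_mul_I
  exact inv_eq_of_mul_eq_one_right h

/-- Taking adjoints exchanges `L` and `L'` and conjugates their coefficients `-(1+i)/2` and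
`-(1-i)/2`, which are conjugate to each other. -/
theorem symmetrize_isFormalAdjoint (h : L'.IsFormalAdjoint L) :
    (symmetrize L L').IsFormalAdjoint (symmetrize L L') := by
  intro x y
  have h1 := h ⟨x, x.2.1⟩ ⟨y, y.2.2⟩
  have h2 := h.symm ⟨x, x.2.2⟩ ⟨y, y.2.1⟩
  rw [symmetrize_apply, symmetrize_apply, inv_I_add_one]
  simp only [inner_neg_left, inner_neg_right, inner_smul_left, inner_smul_right, inner_add_left,
    inner_add_right, map_div₀, map_sub, map_one, Complex.conj_I, Complex.conj_ofNat] at *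
  rw [h1, h2]
  linear_combination (1 / 2 * inner ℂ (x : H) (L' ⟨y, y.2.1⟩)
    - 1 / 2 * inner ℂ (x : H) (L ⟨y, y.2.2⟩)) * Complex.I_mul_I

/-- By duality `⟨x, L'x⟩` is the conjugate of `z = ⟨x, Lx⟩`, so the form equals `-Re((1+i) z)`. -/
theorem re_inner_symmetrize (h : L'.IsFormalAdjoint L) (x : (symmetrize L L').domain) :
    (inner ℂ (x : H) (symmetrize L L' x)).re =
      -(inner ℂ (x : H) (L ⟨x, x.2.2⟩)).re + (inner ℂ (x : H) (L ⟨x, x.2.2⟩)).im := by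
  have h2 : inner ℂ (x : H) (L' ⟨x, x.2.1⟩)
      = (starRingEnd ℂ) (inner ℂ (x : H) (L ⟨x, x.2.2⟩)) := by
    rw [← h ⟨x, x.2.1⟩ ⟨x, x.2.2⟩, inner_conj_symm]
  rw [symmetrize_apply, inv_I_add_one]
  simp only [inner_neg_right, inner_smul_right, inner_add_right, h2]
  generalize inner ℂ (x : H) (L ⟨x, x.2.2⟩) = z
  simp only [Complex.neg_re, Complex.mul_re, Complex.mul_im, Complex.add_re, Complex.add_im,
    Complex.conj_re, Complex.conj_im, Complex.div_ofNat_re, Complex.div_ofNat_im, Complex.sub_re,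
    Complex.sub_im, Complex.one_re, Complex.one_im, Complex.I_re, Complex.I_im]
  ring

end Duality

/-! ### The form Hilbert space and the Friedrichs extension -/

section FormSpace

variable {H : Type*} [NormedAddCommGroup H] [InnerProductSpace ℂ H]

/-- The domain of `A`, to be endowed with the inner product `⟨u, A v⟩ + (1 - c) ⟨u, v⟩`. -/
structure FormCore (A : H →ₗ.[ℂ] H) (c : ℝ) where
  /-- The underlying vector of the domain. -/
  val : A.domain

namespace FormCore

variable (A : H →ₗ.[ℂ] H) (c : ℝ)

/-- The identification of the form core with the domain of `A`. -/
def equiv : FormCore A c ≃ A.domain where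
  toFun := val
  invFun := mk
  left_inv _ := rfl
  right_inv _ := rfl

instance : AddCommGroup (FormCore A c) := (equiv A c).addCommGroup
instance : Module ℂ (FormCore A c) := (equiv A c).module ℂ

variable {A c}

/-- The form `⟨u, A v⟩ + (1 - c) ⟨u, v⟩`. -/
def form (u v : FormCore A c) : ℂ :=
  inner ℂ (u.val : H) (A v.val) + ((1 - c : ℝ) : ℂ) * inner ℂ (u.val : H) (v.val : H)

theorem val_add (u v : FormCore A c) : (u + v).val = u.val + v.val := rfl
theorem val_sub (u v : FormCore A c) : (u - v).val = u.val - v.val := rfl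
theorem val_smul (a : ℂ) (u : FormCore A c) : (a • u).val = a • u.val := rfl

theorem re_form (u : FormCore A c) :
    (form u u).re = (inner ℂ (u.val : H) (A u.val)).re + (1 - c) * ‖(u.val : H)‖ ^ 2 := by
  have h : ‖(u.val : H)‖ ^ 2 = (inner ℂ (u.val : H) (u.val : H)).re :=
    norm_sq_eq_re_inner (𝕜 := ℂ) _
  rw [form, Complex.add_re, Complex.re_ofReal_mul, h]

/-- The shift by `1 - c`, rather than `-c`, is what makes the form definite and the inclusion into
`H` a contraction. -/
theorem norm_sq_le_form (hc : ∀ u : A.domain, c * ‖(u : H)‖ ^ 2 ≤ (inner ℂ (u : H) (A u)).re)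
    (u : FormCore A c) : ‖(u.val : H)‖ ^ 2 ≤ (form u u).re := by
  have h := hc u.val
  rw [re_form]
  linarith

/-- The form of a symmetric, bounded from below operator as an inner product. -/
@[reducible]
def core (hs : A.IsFormalAdjoint A)
    (hc : ∀ u : A.domain, c * ‖(u : H)‖ ^ 2 ≤ (inner ℂ (u : H) (A u)).re) :
    InnerProductSpace.Core ℂ (FormCore A c) where
  inner := form
  conj_inner_symm u v := by
    simp only [form, map_add, map_mul, inner_conj_symm, Complex.conj_ofReal]
    rw [hs]
  re_inner_nonneg u := (sq_nonneg _).trans (norm_sq_le_form hc u)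
  add_left u v w := by
    simp only [form, val_add, Submodule.coe_add, inner_add_left]
    ring
  smul_left u v a := by
    simp only [form, val_smul, Submodule.coe_smul, inner_smul_left]
    ring
  definite u hu := by
    have h : form u u = 0 := hu
    have h2 := norm_sq_le_form hc u
    rw [h, Complex.zero_re] at h2
    have h3 : (u.val : H) = 0 := by
      rw [← norm_eq_zero]
      exact pow_eq_zero_iff (two_ne_zero) |>.1 (le_antisymm h2 (sq_nonneg _))
    exact (equiv A c).injective (Subtype.ext h3)

end FormCore

theorem domain_le_formDomain {A : H →ₗ.[ℂ] H} (hA : IsBoundedBelow A) :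
    A.domain ≤ formDomain A hA := fun x hx =>
  ⟨fun _ => ⟨x, hx⟩, tendsto_const_nhds, by simp⟩

variable [CompleteSpace H]

/-- The Friedrichs resolvent: for a densely defined symmetric `A ≥ c`, the inverse `G` of
`H + 1 - c`, where `H` is the restriction of the adjoint of `A` to the form domain. -/
theorem exists_friedrichs_resolvent {A : H →ₗ.[ℂ] H}
    (hs : A.IsFormalAdjoint A) {c : ℝ} (hA : IsBoundedBelow A)
    (hc : ∀ u : A.domain, c * ‖(u : H)‖ ^ 2 ≤ (inner ℂ (u : H) (A u)).re) :
    ∃ G : H →L[ℂ] H, (∀ x y, inner ℂ (G x) y = inner ℂ x (G y)) ∧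
      (∀ y, ‖G y‖ ^ 2 ≤ (inner ℂ (G y) y).re) ∧
      ∀ x y : H, x = G y ↔ x ∈ formDomain A hA ∧
        ∀ v : A.domain, inner ℂ x (A v + ((1 - c : ℝ) : ℂ) • (v : H)) = inner ℂ y (v : H) := by
  let cr := FormCore.core hs hc
  let _ : NormedAddCommGroup (FormCore A c) := cr.toNormedAddCommGroup
  let _ : InnerProductSpace ℂ (FormCore A c) := InnerProductSpace.ofCore cr.toCore
  have hnorm : ∀ u : FormCore A c, ‖u‖ ^ 2 = (FormCore.form u u).re := fun u => by
    rw [@norm_sq_eq_re_inner ℂ]; rfl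
  let j₀ : FormCore A c →ₗ[ℂ] H :=
    { toFun := fun u => (u.val : H)
      map_add' := fun u v => rfl
      map_smul' := fun a u => rfl }
  have hj₀ : ∀ u, ‖j₀ u‖ ≤ 1 * ‖u‖ := fun u => by
    rw [one_mul]
    refine le_of_sq_le_sq ?_ (norm_nonneg _)
    rw [hnorm]
    exact FormCore.norm_sq_le_form hc u
  let K := UniformSpace.Completion (FormCore A c)
  let ι : FormCore A c →L[ℂ] K := UniformSpace.Completion.toComplL
  have hι : DenseRange ι := UniformSpace.Completion.denseRange_coe
  have hιu : IsUniformInducing ι := UniformSpace.Completion.isUniformInducing_coe _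
  let j : K →L[ℂ] H := (j₀.mkContinuous 1 hj₀).extend ι
  have hj : ∀ u : FormCore A c, j (ι u) = (u.val : H) := fun u =>
    ContinuousLinearMap.extend_eq _ hι hιu u
  have hι_inner : ∀ u v, inner ℂ (ι u) (ι v) = FormCore.form u v := fun u v =>
    UniformSpace.Completion.inner_coe u v
  have hι_norm : ∀ u, ‖ι u‖ = ‖u‖ := fun u => UniformSpace.Completion.norm_coe u
  -- True by definition on the core, hence everywhere by density. It shows that `ξ` is determined by
  -- `j ξ`, so closability of the form needs no separate argument.
  have key : ∀ (ξ : K) (v : FormCore A c), inner ℂ ξ (ι v)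
      = inner ℂ (j ξ) (A v.val + ((1 - c : ℝ) : ℂ) • (v.val : H)) := fun ξ v => by
    refine hι.induction_on ξ (isClosed_eq (by fun_prop) (by fun_prop)) fun u => ?_
    rw [hι_inner, hj, inner_add_right, inner_smul_right]
    rfl
  have hj_le : ∀ ξ, ‖j ξ‖ ≤ ‖ξ‖ := fun ξ => by
    refine hι.induction_on ξ (isClosed_le (by fun_prop) (by fun_prop)) fun u => ?_
    rw [hj, hι_norm, ← one_mul ‖u‖]
    exact hj₀ u
  -- For sequences converging in `H`, the shift term tends to zero. Being Cauchy in the form norm is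
  -- then the condition in `formDomain`, which identifies that subspace with the range of `j`.
  have hdist : ∀ (x : H) (u : ℕ → FormCore A c),
      Tendsto (fun n => ((u n).val : H)) atTop (𝓝 x) →
      (CauchySeq u ↔ Tendsto (fun k : ℕ × ℕ =>
        (inner ℂ (((u k.1).val - (u k.2).val : A.domain) : H)
          (A ((u k.1).val - (u k.2).val))).re) atTop (𝓝 0)) := by
    intro x u hu
    have h0 : Tendsto (fun k : ℕ × ℕ => (1 - c) * ‖((u k.1).val : H) - (u k.2).val‖ ^ 2) atTop
        (𝓝 0) := by
      have h1 : Tendsto (fun k : ℕ × ℕ => ((u k.1).val : H)) atTop (𝓝 x) := by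
        rw [← prod_atTop_atTop_eq]; exact hu.comp tendsto_fst
      have h2 : Tendsto (fun k : ℕ × ℕ => ((u k.2).val : H)) atTop (𝓝 x) := by
        rw [← prod_atTop_atTop_eq]; exact hu.comp tendsto_snd
      simpa using ((h1.sub h2).norm.pow 2).const_mul (1 - c)
    have e : ∀ k : ℕ × ℕ, dist (u k.1) (u k.2) ^ 2
        = (inner ℂ (((u k.1).val - (u k.2).val : A.domain) : H)
          (A ((u k.1).val - (u k.2).val))).re
          + (1 - c) * ‖((u k.1).val : H) - (u k.2).val‖ ^ 2 := fun k => by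
      rw [dist_eq_norm, hnorm, FormCore.re_form, FormCore.val_sub, Submodule.coe_sub]
    rw [cauchySeq_iff_tendsto_dist_atTop_0]
    constructor
    · intro h
      have h3 := (h.pow 2).sub h0
      simp only [e] at h3
      simpa using h3
    · intro h
      have h3 := (h.add h0).sqrt
      simp only [← e] at h3
      simpa [Real.sqrt_sq dist_nonneg] using h3
  have hform : ∀ x, x ∈ formDomain A hA ↔ ∃ ξ, j ξ = x := by
    intro x
    constructor
    · rintro ⟨u, hu, hu'⟩
      have hc : CauchySeq fun n => ι ⟨u n⟩ :=
        ((hdist x (fun n => ⟨u n⟩) hu).2 hu').map ι.uniformContinuous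
      obtain ⟨ξ, hξ⟩ := cauchySeq_tendsto_of_complete hc
      refine ⟨ξ, tendsto_nhds_unique ((j.continuous.tendsto ξ).comp hξ) ?_⟩
      exact hu.congr fun n => (hj _).symm
    · rintro ⟨ξ, rfl⟩
      obtain ⟨v, hv, hvξ⟩ := mem_closure_iff_seq_limit.1 (hι ξ)
      choose u hu using hv
      have hju : Tendsto (fun n => ((u n).val : H)) atTop (𝓝 (j ξ)) :=
        ((j.continuous.tendsto ξ).comp hvξ).congr fun n => by
          rw [Function.comp_apply, ← hu, hj]
      refine ⟨fun n => (u n).val, hju, (hdist _ u hju).1 ?_⟩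
      refine hιu.cauchy_map_iff.1 ?_
      have : ι ∘ u = v := funext hu
      rw [Filter.map_map, this]
      exact hvξ.cauchySeq
  -- The Riesz representative of `v ↦ ⟨y, j v⟩` in the form space is `j† y`; its image in `H` solves
  -- the shifted equation weakly.
  refine ⟨j ∘L j.adjoint, fun x y => ?_, fun y => ?_, fun x y => ?_⟩
  · change inner ℂ (j (j.adjoint x)) y = inner ℂ x (j (j.adjoint y))
    rw [← ContinuousLinearMap.adjoint_inner_right, ContinuousLinearMap.adjoint_inner_left]
  · have h : inner ℂ ((j ∘L j.adjoint) y) y = inner ℂ (j.adjoint y) (j.adjoint y) := by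
      rw [ContinuousLinearMap.adjoint_inner_right]; rfl
    have h2 : ‖(j ∘L j.adjoint) y‖ ≤ ‖j.adjoint y‖ := hj_le _
    rw [h]
    have h3 : ‖j.adjoint y‖ ^ 2 = (inner ℂ (j.adjoint y) (j.adjoint y)).re :=
      norm_sq_eq_re_inner (𝕜 := ℂ) _
    rw [← h3]
    gcongr
  · rw [hform]
    constructor
    · rintro rfl
      refine ⟨⟨_, rfl⟩, fun v => ?_⟩
      have := key (j.adjoint y) ⟨v⟩
      rw [ContinuousLinearMap.adjoint_inner_left, hj] at this
      exact this.symm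
    · rintro ⟨⟨ξ, rfl⟩, h⟩
      -- The core is dense, so an element of the completion is determined by its inner products with
      -- the core.
      have : ξ = j.adjoint y := by
        refine hι.eq_of_inner_left ℂ ?_
        intro v
        rw [key, ContinuousLinearMap.adjoint_inner_left, hj]
        exact h v.val
      rw [this]
      rfl

theorem mem_graph_adjoint {A : H →ₗ.[ℂ] H} (hd : Dense (A.domain : Set H)) {x w : H} :
    (x, w) ∈ A.adjoint.graph ↔ ∀ v : A.domain, inner ℂ x (A v) = inner ℂ w (v : H) := by
  rw [LinearPMap.adjoint_graph_eq_graph_adjoint hd, Submodule.mem_adjoint_iff]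
  constructor
  · intro h v
    have := h v (A v) (A.mem_graph v)
    rw [sub_eq_zero] at this
    rw [← inner_conj_symm, ← inner_conj_symm w, this]
  · intro h a b hab
    obtain ⟨v, rfl, rfl⟩ := (LinearPMap.mem_graph_iff _).1 hab
    rw [sub_eq_zero, ← inner_conj_symm, ← inner_conj_symm (v : H), h]

theorem mem_graph_friedrichs {A : H →ₗ.[ℂ] H} (hA : IsSymmetricSemibounded A) {x w : H} :
    (x, w) ∈ (friedrichs A hA).graph ↔
      x ∈ formDomain A hA.boundedBelow ∧ ∀ v : A.domain, inner ℂ x (A v) = inner ℂ w (v : H) := by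
  rw [← mem_graph_adjoint hA.dense]
  constructor
  · intro h
    exact ⟨(LinearPMap.mem_domain_of_mem_graph h).1,
      LinearPMap.le_graph_of_le LinearPMap.domRestrict_le h⟩
  · rintro ⟨h1, h2⟩
    exact mem_graph_domRestrict h1 h2

theorem le_friedrichs {A : H →ₗ.[ℂ] H} (hA : IsSymmetricSemibounded A) :
    A ≤ friedrichs A hA := by
  refine LinearPMap.le_of_le_graph ?_
  rintro ⟨x, w⟩ h
  obtain ⟨u, rfl, rfl⟩ := (LinearPMap.mem_graph_iff _).1 h
  exact (mem_graph_friedrichs hA).2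
    ⟨domain_le_formDomain _ u.2, fun v => (hA.symmetric u v).symm⟩

/-- An operator `B` such that `B + a` has the bounded inverse `G` with `G` symmetric is
self-adjoint. -/
theorem isSelfAdjoint_of_resolvent {B : H →ₗ.[ℂ] H} (hd : Dense (B.domain : Set H))
    (G : H →L[ℂ] H) (hG : ∀ x y, inner ℂ (G x) y = inner ℂ x (G y)) (a : ℝ)
    (hB : ∀ x w, (x, w) ∈ B.graph ↔ x = G (w + (a : ℂ) • x)) : IsSelfAdjoint B := by
  have hGB : ∀ y, (G y, y - (a : ℂ) • G y) ∈ B.graph := fun y => by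
    rw [hB, sub_add_cancel]
  rw [LinearPMap.isSelfAdjoint_def]
  refine LinearPMap.eq_of_eq_graph ?_
  ext ⟨x, w⟩
  rw [mem_graph_adjoint hd]
  constructor
  · intro h
    rw [hB]
    -- Since `G` is defined everywhere, each `y` can be tested by inserting `G y`, which lies in the
    -- domain of `B`, into the adjoint relation.
    refine ext_inner_right ℂ fun y => ?_
    obtain ⟨v, hv, hv2⟩ := (LinearPMap.mem_graph_iff _).1 (hGB y)
    have h1 := h v
    simp only at hv hv2
    rw [hv, hv2, inner_sub_right, inner_smul_right] at h1
    rw [hG, inner_add_left, inner_smul_left, Complex.conj_ofReal, ← h1]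
    ring
  · intro h v
    rw [hB] at h
    have hv := (hB _ _).1 (B.mem_graph v)
    have e : inner ℂ x (B v + (a : ℂ) • (v : H)) = inner ℂ (w + (a : ℂ) • x) (v : H) := by
      conv_lhs => rw [h]
      conv_rhs => rw [hv]
      rw [hG]
    rw [inner_add_right, inner_add_left, inner_smul_left, inner_smul_right,
      Complex.conj_ofReal] at e
    exact add_right_cancel e

theorem friedrichs_isSelfAdjoint_isBoundedBelow {A : H →ₗ.[ℂ] H} (hA : IsSymmetricSemibounded A) :
    IsSelfAdjoint (friedrichs A hA) ∧ IsBoundedBelow (friedrichs A hA) := by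
  obtain ⟨c, hc⟩ := hA.boundedBelow
  obtain ⟨G, hG, hpos, hGA⟩ :=
    exists_friedrichs_resolvent hA.symmetric hA.boundedBelow hc
  have hB : ∀ x w, (x, w) ∈ (friedrichs A hA).graph ↔ x = G (w + ((1 - c : ℝ) : ℂ) • x) := by
    intro x w
    rw [mem_graph_friedrichs, hGA]
    refine and_congr_right fun _ => forall_congr' fun v => ?_
    rw [inner_add_right, inner_add_left, inner_smul_left, inner_smul_right, Complex.conj_ofReal]
    exact (add_left_inj _).symm
  refine ⟨isSelfAdjoint_of_resolvent (hA.dense.mono (le_friedrichs hA).1) G hG _ hB, c,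
    fun u => ?_⟩
  have hu := (hB _ _).1 ((friedrichs A hA).mem_graph u)
  -- With `y = (B + 1 - c) u` and `u = G y`, the bound `‖G y‖² ≤ Re⟨G y, y⟩` is the lower bound `c`
  -- for the extension `B`.
  have h := hpos (friedrichs A hA u + ((1 - c : ℝ) : ℂ) • (u : H))
  rw [← hu, inner_add_right, inner_smul_right, Complex.add_re, Complex.re_ofReal_mul] at h
  have h3 : ‖(u : H)‖ ^ 2 = (inner ℂ (u : H) (u : H)).re := norm_sq_eq_re_inner (𝕜 := ℂ) _
  rw [← h3] at h
  linarith

end FormSpace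

/-! ### Tensor products of subspaces and operators -/

section TensorTools

open scoped TensorProduct

variable {α β : Type*} [MeasurableSpace α] [MeasurableSpace β]
  {μ : Measure α} {ν : Measure β}

theorem ae_prod_fst {s : α → Prop} (hs : ∀ᵐ x ∂μ, s x) : ∀ᵐ z ∂μ.prod ν, s z.1 :=
  Measure.quasiMeasurePreserving_fst.ae hs

theorem ae_prod_snd {s : β → Prop} (hs : ∀ᵐ x ∂ν, s x) : ∀ᵐ z ∂μ.prod ν, s z.2 :=
  Measure.quasiMeasurePreserving_snd.ae hs

variable [SFinite ν]

theorem coeFn_tensorLp (f : Lp ℂ 2 μ) (g : Lp ℂ 2 ν) :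
    tensorLp f g =ᵐ[μ.prod ν] fun z => f z.1 * g z.2 :=
  MemLp.coeFn_toLp _

/-- The product function as a bilinear map. -/
def tensorBilin (μ : Measure α) (ν : Measure β) [SFinite ν] :
    Lp ℂ 2 μ →ₗ[ℂ] Lp ℂ 2 ν →ₗ[ℂ] Lp ℂ 2 (μ.prod ν) :=
  LinearMap.mk₂ ℂ tensorLp
    (fun f f' g => by
      refine Lp.ext ?_
      filter_upwards [coeFn_tensorLp (f + f') g, coeFn_tensorLp f g, coeFn_tensorLp f' g,
        Lp.coeFn_add (tensorLp f g) (tensorLp f' g), ae_prod_fst (ν := ν) (Lp.coeFn_add f f')]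
        with z h1 h2 h3 h4 h5
      rw [h1, h4, h5, Pi.add_apply, Pi.add_apply, h2, h3, add_mul])
    (fun c f g => by
      refine Lp.ext ?_
      filter_upwards [coeFn_tensorLp (c • f) g, coeFn_tensorLp f g,
        Lp.coeFn_smul c (tensorLp f g), ae_prod_fst (ν := ν) (Lp.coeFn_smul c f)]
        with z h1 h2 h3 h4
      rw [h1, h3, h4, Pi.smul_apply, Pi.smul_apply, h2, smul_eq_mul, smul_eq_mul, mul_assoc])
    (fun f g g' => by
      refine Lp.ext ?_
      filter_upwards [coeFn_tensorLp f (g + g'), coeFn_tensorLp f g, coeFn_tensorLp f g',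
        Lp.coeFn_add (tensorLp f g) (tensorLp f g'), ae_prod_snd (μ := μ) (Lp.coeFn_add g g')]
        with z h1 h2 h3 h4 h5
      rw [h1, h4, h5, Pi.add_apply, Pi.add_apply, h2, h3, mul_add])
    (fun c f g => by
      refine Lp.ext ?_
      filter_upwards [coeFn_tensorLp f (c • g), coeFn_tensorLp f g,
        Lp.coeFn_smul c (tensorLp f g), ae_prod_snd (μ := μ) (Lp.coeFn_smul c g)]
        with z h1 h2 h3 h4
      rw [h1, h3, h4, Pi.smul_apply, Pi.smul_apply, h2, smul_eq_mul, smul_eq_mul, mul_left_comm])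

theorem tensorBilin_apply (f : Lp ℂ 2 μ) (g : Lp ℂ 2 ν) :
    tensorBilin μ ν f g = tensorLp f g := rfl

theorem inner_tensorLp [SFinite μ] (f f' : Lp ℂ 2 μ) (g g' : Lp ℂ 2 ν) :
    inner ℂ (tensorLp f g) (tensorLp f' g') = inner ℂ f f' * inner ℂ g g' := by
  simp only [L2.inner_def]
  rw [← integral_prod_mul]
  refine integral_congr_ae ?_
  filter_upwards [coeFn_tensorLp f g, coeFn_tensorLp f' g'] with z h1 h2
  rw [h1, h2]
  simp only [RCLike.inner_apply, map_mul]
  ring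

theorem norm_tensorLp [SFinite μ] (f : Lp ℂ 2 μ) (g : Lp ℂ 2 ν) :
    ‖tensorLp f g‖ = ‖f‖ * ‖g‖ := by
  have h : (‖tensorLp f g‖ : ℂ) ^ 2 = ((‖f‖ * ‖g‖ : ℝ) : ℂ) ^ 2 := by
    have := inner_tensorLp f f g g
    simp only [inner_self_eq_norm_sq_to_K] at this
    rw [Complex.ofReal_mul, mul_pow]
    exact this
  have h2 : ‖tensorLp f g‖ ^ 2 = (‖f‖ * ‖g‖) ^ 2 := by exact_mod_cast h
  exact (pow_left_inj₀ (norm_nonneg _) (by positivity) two_ne_zero).1 h2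

theorem continuous_tensorLp [SFinite μ] :
    Continuous fun z : Lp ℂ 2 μ × Lp ℂ 2 ν => tensorLp z.1 z.2 :=
  ((tensorBilin μ ν).mkContinuous₂ 1 fun f g => by
    rw [tensorBilin_apply, norm_tensorLp, one_mul]).continuous₂

/-- The map from the algebraic tensor product to `L²(μ ⊗ ν)`. -/
def tensorLift (μ : Measure α) (ν : Measure β) [SFinite ν] :
    Lp ℂ 2 μ ⊗[ℂ] Lp ℂ 2 ν →ₗ[ℂ] Lp ℂ 2 (μ.prod ν) :=
  TensorProduct.lift (tensorBilin μ ν)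

theorem tensorLift_tmul (f : Lp ℂ 2 μ) (g : Lp ℂ 2 ν) :
    tensorLift μ ν (f ⊗ₜ g) = tensorLp f g := rfl

theorem inner_tensorLift [SFinite μ] (x y : Lp ℂ 2 μ ⊗[ℂ] Lp ℂ 2 ν) :
    inner ℂ (tensorLift μ ν x) (tensorLift μ ν y) = inner ℂ x y := by
  induction x with
  | zero => simp
  | add x x' hx hx' => rw [map_add, inner_add_left, inner_add_left, hx, hx']
  | tmul f g =>
    induction y with
    | zero => simp
    | add y y' hy hy' => rw [map_add, inner_add_right, inner_add_right, hy, hy']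
    | tmul f' g' =>
      rw [tensorLift_tmul, tensorLift_tmul, inner_tensorLp, TensorProduct.inner_tmul]

/-- The algebraic tensor product carries an inner product that the lift preserves. Injectivity
allows identities between functions to be lifted to abstract tensors. -/
theorem tensorLift_injective [SFinite μ] : Function.Injective (tensorLift μ ν) := by
  refine (injective_iff_map_eq_zero _).2 fun x hx => ?_
  rw [← inner_self_eq_zero (𝕜 := ℂ), ← inner_tensorLift, hx, inner_zero_left]

/-- Elements of `V ⊗ W` as a subspace of `L²(μ ⊗ ν)` come from the algebraic tensor product. -/
theorem exists_lift_eq {V : Submodule ℂ (Lp ℂ 2 μ)} {W : Submodule ℂ (Lp ℂ 2 ν)}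
    {F : Lp ℂ 2 (μ.prod ν)} (hF : F ∈ tensorSubmodule V W) :
    ∃ z : V ⊗[ℂ] W, tensorLift μ ν (TensorProduct.map V.subtype W.subtype z) = F := by
  induction hF using Submodule.span_induction with
  | mem F h =>
    obtain ⟨f, hf, g, hg, rfl⟩ := h
    exact ⟨(⟨f, hf⟩ : V) ⊗ₜ (⟨g, hg⟩ : W), rfl⟩
  | zero => exact ⟨0, by simp⟩
  | add F G _ _ hF hG =>
    obtain ⟨x, rfl⟩ := hF
    obtain ⟨y, rfl⟩ := hG
    exact ⟨x + y, by simp⟩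
  | smul c F _ hF =>
    obtain ⟨x, rfl⟩ := hF
    exact ⟨c • x, by simp⟩

theorem lift_map_mem {V : Submodule ℂ (Lp ℂ 2 μ)} {W : Submodule ℂ (Lp ℂ 2 ν)} {M N : Type*}
    [AddCommGroup M] [Module ℂ M] [AddCommGroup N] [Module ℂ N]
    (a : M →ₗ[ℂ] Lp ℂ 2 μ) (b : N →ₗ[ℂ] Lp ℂ 2 ν) (ha : ∀ m, a m ∈ V) (hb : ∀ n, b n ∈ W)
    (z : M ⊗[ℂ] N) : tensorLift μ ν (TensorProduct.map a b z) ∈ tensorSubmodule V W := by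
  induction z with
  | zero => simp
  | add x y hx hy => rw [map_add, map_add]; exact add_mem hx hy
  | tmul m n => exact Submodule.subset_span ⟨a m, ha m, b n, hb n, rfl⟩

/-- There is a linear map that is the identity on `V₁` and maps `V₂` into `V₁ ⊓ V₂`. -/
theorem exists_projection {E : Type*} [AddCommGroup E] [Module ℂ E] (V₁ V₂ : Submodule ℂ E) :
    ∃ P : E →ₗ[ℂ] E, (∀ x ∈ V₁, P x = x) ∧ ∀ x ∈ V₂, P x ∈ V₁ ⊓ V₂ := by
  -- Split `V₂` as `(V₁ ⊓ V₂) ⊕ C`. Then `C` meets `V₁` trivially, so some complement `D` of `V₁`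
  -- contains `C`, and the projection onto `V₁` along `D` kills `C`.
  obtain ⟨C, hC⟩ := Submodule.exists_isCompl ((V₁ ⊓ V₂).comap V₂.subtype)
  have hdisj : Disjoint V₁ (C.map V₂.subtype) := by
    rw [Submodule.disjoint_def]
    rintro _ hx ⟨y, hy, rfl⟩
    have := Submodule.disjoint_def.1 hC.disjoint y ⟨hx, y.2⟩ hy
    simp [this]
  obtain ⟨D, hCD, hD⟩ := hdisj.symm.exists_isCompl
  refine ⟨V₁.projection D hD.symm, fun x hx => Submodule.projection_apply_of_mem_left _ hx,
    fun x hx => ?_⟩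
  obtain ⟨v, hv, w, hw, hvw⟩ := Submodule.mem_sup.1
    (hC.codisjoint.eq_top ▸ Submodule.mem_top : (⟨x, hx⟩ : V₂) ∈ _ ⊔ C)
  have hx' : x = v + w := (congrArg Subtype.val hvw).symm
  have hwD : (w : E) ∈ D := hCD ⟨w, hw, rfl⟩
  have hvV : (v : E) ∈ V₁ := hv.1
  rw [hx', map_add, Submodule.projection_apply_of_mem_left _ hvV,
    (Submodule.projection_apply_eq_zero_iff _).2 hwD, add_zero]
  exact hv

/-- With `P` and `Q` from `exists_projection`, the map `P ⊗ Q` fixes an element written in `V₁ ⊗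
W₁`, and sends the same element written in `V₂ ⊗ W₂` into the tensor product of the intersections.
-/
theorem tensorSubmodule_inf [SFinite μ] (V₁ V₂ : Submodule ℂ (Lp ℂ 2 μ))
    (W₁ W₂ : Submodule ℂ (Lp ℂ 2 ν)) :
    tensorSubmodule V₁ W₁ ⊓ tensorSubmodule V₂ W₂ ≤ tensorSubmodule (V₁ ⊓ V₂) (W₁ ⊓ W₂) := by
  rintro F ⟨h1, h2⟩
  obtain ⟨P, hP1, hP2⟩ := exists_projection V₁ V₂
  obtain ⟨Q, hQ1, hQ2⟩ := exists_projection W₁ W₂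
  obtain ⟨x, hx⟩ := exists_lift_eq h1
  obtain ⟨y, rfl⟩ := exists_lift_eq h2
  have hxy := tensorLift_injective hx
  have hp : P ∘ₗ V₁.subtype = V₁.subtype := LinearMap.ext fun v => hP1 v v.2
  have hq : Q ∘ₗ W₁.subtype = W₁.subtype := LinearMap.ext fun v => hQ1 v v.2
  have e := congrArg (TensorProduct.map P Q) hxy
  rw [← LinearMap.comp_apply, ← TensorProduct.map_comp, hp, hq, hxy, ← LinearMap.comp_apply,
    ← TensorProduct.map_comp] at e
  rw [e]
  exact lift_map_mem _ _ (fun m => hP2 m.1 m.2) (fun n => hQ2 n.1 n.2) y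

variable {A : Lp ℂ 2 μ →ₗ.[ℂ] Lp ℂ 2 μ} {B : Lp ℂ 2 ν →ₗ.[ℂ] Lp ℂ 2 ν}

/-- The graph is single-valued because `D(A) ⊗ D(B)` embeds in `L²`: a vanishing first component
forces the underlying abstract tensor, and with it the second component, to vanish. -/
theorem tensorOp_graph [SFinite μ] : (tensorOp A B).graph =
    Submodule.span ℂ (Set.range fun z : A.domain × B.domain =>
      (tensorLp (z.1 : Lp ℂ 2 μ) (z.2 : Lp ℂ 2 ν), tensorLp (A z.1) (B z.2))) := by
  refine Submodule.toLinearPMap_graph_eq _ fun x hx h0 => ?_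
  have h : ∃ z : A.domain ⊗[ℂ] B.domain,
      tensorLift μ ν (TensorProduct.map A.domain.subtype B.domain.subtype z) = x.1 ∧
      tensorLift μ ν (TensorProduct.map A.toFun B.toFun z) = x.2 := by
    clear h0
    induction hx using Submodule.span_induction with
    | mem x h =>
      obtain ⟨⟨f, g⟩, rfl⟩ := h
      exact ⟨f ⊗ₜ g, rfl, rfl⟩
    | zero => exact ⟨0, by simp, by simp⟩
    | add x y _ _ hx hy =>
      obtain ⟨a, ha1, ha2⟩ := hx
      obtain ⟨b, hb1, hb2⟩ := hy
      exact ⟨a + b, by simp [ha1, hb1], by simp [ha2, hb2]⟩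
    | smul c x _ hx =>
      obtain ⟨a, ha1, ha2⟩ := hx
      exact ⟨c • a, by simp [ha1], by simp [ha2]⟩
  obtain ⟨z, h1, h2⟩ := h
  rw [h0] at h1
  have hz : z = 0 := by
    have hinj : Function.Injective (TensorProduct.map A.domain.subtype B.domain.subtype) :=
      TensorProduct.map_injective_of_flat_flat _ _ A.domain.injective_subtype
        B.domain.injective_subtype
    refine (injective_iff_map_eq_zero (tensorLift μ ν ∘ₗ _)).1 ?_ z h1
    rw [LinearMap.coe_comp]
    exact tensorLift_injective.comp hinj
  rw [← h2, hz, map_zero, map_zero]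

theorem mem_graph_tensorOp [SFinite μ] {f f' : Lp ℂ 2 μ} {g g' : Lp ℂ 2 ν}
    (hA : (f, f') ∈ A.graph) (hB : (g, g') ∈ B.graph) :
    (tensorLp f g, tensorLp f' g') ∈ (tensorOp A B).graph := by
  obtain ⟨a, rfl, rfl⟩ := (LinearPMap.mem_graph_iff _).1 hA
  obtain ⟨b, rfl, rfl⟩ := (LinearPMap.mem_graph_iff _).1 hB
  rw [tensorOp_graph]
  exact Submodule.subset_span ⟨(a, b), rfl⟩

theorem tensorOp_domain_le [SFinite μ] :
    (tensorOp A B).domain ≤ tensorSubmodule A.domain B.domain := by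
  rw [← LinearPMap.graph_map_fst_eq_domain, tensorOp_graph, Submodule.map_span]
  refine Submodule.span_mono ?_
  rintro _ ⟨_, ⟨z, rfl⟩, rfl⟩
  exact ⟨z.1, z.1.2, z.2, z.2.2, rfl⟩

end TensorTools

/-! ### Time translations and the space `H¹` -/

section Time

/-- Time translation `g ↦ g(· + r)` on `L²(ℝ)`. -/
def timeShift (r : ℝ) : Lp ℂ 2 (volume : Measure ℝ) →ₗᵢ[ℂ] Lp ℂ 2 (volume : Measure ℝ) :=
  Lp.compMeasurePreservingₗᵢ ℂ (fun s : ℝ => s + r) (measurePreserving_add_right volume r)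

theorem coeFn_timeShift (r : ℝ) (g : Lp ℂ 2 (volume : Measure ℝ)) :
    timeShift r g =ᵐ[volume] fun s => g (s + r) :=
  Lp.coeFn_compMeasurePreserving g (measurePreserving_add_right volume r)

theorem continuous_timeShift (g : Lp ℂ 2 (volume : Measure ℝ)) :
    Continuous fun r : ℝ => timeShift r g := by
  let F : C(ℝ, C(ℝ, ℝ)) := (ContinuousMap.mk (fun z : ℝ × ℝ => z.2 + z.1) (by fun_prop)).curry
  exact Continuous.compMeasurePreservingLp (f := fun _ : ℝ => g) (g := F) continuous_const
    F.continuous (fun r => measurePreserving_add_right volume r) (by norm_num)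

theorem timeShift_zero (g : Lp ℂ 2 (volume : Measure ℝ)) : timeShift 0 g = g := by
  refine Lp.ext ?_
  filter_upwards [coeFn_timeShift 0 g] with s hs
  rw [hs, add_zero]

theorem enorm_sq_eq_lintegral {α : Type*} [MeasurableSpace α] {μ : Measure α} (f : Lp ℂ 2 μ) :
    ‖f‖ₑ ^ 2 = ∫⁻ x, ‖f x‖ₑ ^ 2 ∂μ := by
  have h := eLpNorm_nnreal_pow_eq_lintegral (f := f) (μ := μ) (p := 2) (by norm_num)
  rw [Lp.enorm_def]
  simpa using h

theorem intervalIntegrable_Lp (h : Lp ℂ 2 (volume : Measure ℝ)) (a b : ℝ) :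
    IntervalIntegrable h volume a b :=
  (((Lp.memLp h).locallyIntegrable (by norm_num)).integrableOn_isCompact
    isCompact_uIcc).intervalIntegrable

theorem mem_timeDerivGraph {g h : Lp ℂ 2 (volume : Measure ℝ)} :
    (g, h) ∈ timeDerivGraph ↔ ∃ c : ℂ, ∀ᵐ t : ℝ, g t = c + ∫ s in (0 : ℝ)..t, h s := Iff.rfl

/-- The difference quotients of an indefinite integral are averages of translates. -/
theorem coeFn_differenceQuotient {g h : Lp ℂ 2 (volume : Measure ℝ)}
    (hgh : (g, h) ∈ timeDerivGraph) {r : ℝ} (hr : r ≠ 0) :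
    (((r : ℂ)⁻¹ • (timeShift r g - g) - h : Lp ℂ 2 (volume : Measure ℝ)) : ℝ → ℂ) =ᵐ[volume]
      fun s => ∫ u in Set.Ioc (0 : ℝ) 1, (h (s + r * u) - h s) := by
  obtain ⟨c, hc⟩ := mem_timeDerivGraph.1 hgh
  have hc' : ∀ᵐ s : ℝ, g (s + r) = c + ∫ x in (0 : ℝ)..(s + r), h x :=
    (measurePreserving_add_right volume r).quasiMeasurePreserving.ae hc
  filter_upwards [hc, hc', coeFn_timeShift r g, Lp.coeFn_sub ((r : ℂ)⁻¹ • (timeShift r g - g)) h,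
    Lp.coeFn_smul (r : ℂ)⁻¹ (timeShift r g - g), Lp.coeFn_sub (timeShift r g) g]
    with s h1 h2 h3 h4 h5 h6
  rw [h4, Pi.sub_apply, h5, Pi.smul_apply, h6, Pi.sub_apply, h3, h1, h2,
    ← intervalIntegral.integral_of_le zero_le_one, intervalIntegral.integral_sub,
    intervalIntegral.integral_comp_add_mul _ hr, add_sub_add_left_eq_sub,
    intervalIntegral.integral_interval_sub_left (intervalIntegrable_Lp _ _ _)
      (intervalIntegrable_Lp _ _ _)]
  · simp
  · have := ((intervalIntegrable_Lp h s (s + r)).comp_add_left s).comp_mul_left (c := r)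
    simpa [hr] using this
  · simp

/-- Jensen's inequality on the unit interval followed by Tonelli. Convergence of difference
quotients is thereby reduced to strong continuity of translations. -/
theorem enorm_differenceQuotient_sq_le {g h : Lp ℂ 2 (volume : Measure ℝ)}
    (hgh : (g, h) ∈ timeDerivGraph) {r : ℝ} (hr : r ≠ 0) :
    ‖(r : ℂ)⁻¹ • (timeShift r g - g) - h‖ₑ ^ 2 ≤
      ∫⁻ u in Set.Ioc (0 : ℝ) 1, ‖timeShift (r * u) h - h‖ₑ ^ 2 := by
  have hm := Lp.stronglyMeasurable h
  have : IsProbabilityMeasure (volume.restrict (Set.Ioc (0 : ℝ) 1)) := ⟨by simp⟩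
  calc ‖(r : ℂ)⁻¹ • (timeShift r g - g) - h‖ₑ ^ 2
      = ∫⁻ s, ‖∫ u in Set.Ioc (0 : ℝ) 1, (h (s + r * u) - h s)‖ₑ ^ 2 := by
        rw [enorm_sq_eq_lintegral]
        refine lintegral_congr_ae ?_
        filter_upwards [coeFn_differenceQuotient hgh hr] with s hs
        rw [hs]
    _ ≤ ∫⁻ s, ∫⁻ u in Set.Ioc (0 : ℝ) 1, ‖h (s + r * u) - h s‖ₑ ^ 2 :=
        lintegral_mono fun s => enorm_integral_sq_le
          ((hm.comp_measurable (by fun_prop)).sub stronglyMeasurable_const)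
    _ = ∫⁻ u in Set.Ioc (0 : ℝ) 1, ∫⁻ s, ‖h (s + r * u) - h s‖ₑ ^ 2 := by
        refine lintegral_lintegral_swap (Measurable.aemeasurable ?_)
        have := hm.measurable
        fun_prop
    _ = ∫⁻ u in Set.Ioc (0 : ℝ) 1, ‖timeShift (r * u) h - h‖ₑ ^ 2 := by
        refine lintegral_congr fun u => ?_
        rw [enorm_sq_eq_lintegral]
        refine lintegral_congr_ae ?_
        filter_upwards [coeFn_timeShift (r * u) h, Lp.coeFn_sub (timeShift (r * u) h) h]
          with s h1 h2
        rw [h2, Pi.sub_apply, h1]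

/-- The difference quotients of `g` in `H¹` converge in `L²` to its derivative. -/
theorem tendsto_differenceQuotient {g h : Lp ℂ 2 (volume : Measure ℝ)}
    (hgh : (g, h) ∈ timeDerivGraph) :
    Tendsto (fun r : ℝ => (r : ℂ)⁻¹ • (timeShift r g - g)) (𝓝[≠] 0) (𝓝 h) := by
  rw [Metric.tendsto_nhds]
  intro ε hε
  have hcont : ∀ᶠ r in 𝓝 (0 : ℝ), ‖timeShift r h - h‖ < ε / 2 := by
    have h1 : Tendsto (fun r : ℝ => ‖timeShift r h - h‖) (𝓝 0) (𝓝 0) := by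
      have := ((continuous_timeShift h).sub (continuous_const (y := h))).norm.tendsto (0 : ℝ)
      simpa [timeShift_zero] using this
    exact h1.eventually_lt_const (half_pos hε)
  obtain ⟨δ, hδ, hball⟩ := Metric.eventually_nhds_iff.1 hcont
  have hnear : ∀ᶠ r in 𝓝[≠] (0 : ℝ), dist r 0 < δ :=
    nhdsWithin_le_nhds (Metric.ball_mem_nhds 0 hδ)
  filter_upwards [hnear, self_mem_nhdsWithin] with r hr hr0
  have hle : ‖(r : ℂ)⁻¹ • (timeShift r g - g) - h‖ₑ ^ 2 ≤ ENNReal.ofReal (ε / 2) ^ 2 := by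
    refine (enorm_differenceQuotient_sq_le hgh hr0).trans ?_
    calc ∫⁻ u in Set.Ioc (0 : ℝ) 1, ‖timeShift (r * u) h - h‖ₑ ^ 2
        ≤ ∫⁻ u in Set.Ioc (0 : ℝ) 1, ENNReal.ofReal (ε / 2) ^ 2 := by
          refine setLIntegral_mono (by fun_prop) fun u hu => ?_
          gcongr
          rw [← ofReal_norm]
          refine ENNReal.ofReal_le_ofReal (hball ?_).le
          rw [dist_zero_right] at hr ⊢
          rw [norm_mul]
          refine lt_of_le_of_lt ?_ hr
          refine mul_le_of_le_one_right (norm_nonneg _) ?_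
          rw [Real.norm_of_nonneg hu.1.le]
          exact hu.2
      _ = ENNReal.ofReal (ε / 2) ^ 2 := by simp
  rw [dist_eq_norm]
  have h3 : ‖(r : ℂ)⁻¹ • (timeShift r g - g) - h‖ₑ ≤ ENNReal.ofReal (ε / 2) :=
    (ENNReal.pow_right_strictMono two_ne_zero).le_iff_le.1 hle
  rw [← ofReal_norm, ENNReal.ofReal_le_ofReal_iff (by positivity)] at h3
  linarith

/-- The derivative is the `L²` limit of difference quotients, hence determined by the function. -/
theorem timeDeriv_graph : timeDeriv.graph = timeDerivGraph := by
  refine Submodule.toLinearPMap_graph_eq _ ?_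
  rintro ⟨g, h⟩ hgh h0
  have ht := tendsto_differenceQuotient hgh
  simp only at h0
  simp only [h0, map_zero, sub_zero, smul_zero] at ht
  exact tendsto_nhds_unique ht tendsto_const_nhds

/-- Reduces absolute continuity of complex primitives to real integrands. -/
theorem intervalIntegral_eq_re_add_im {h : ℝ → ℂ} (hh : ∀ a b, IntervalIntegrable h volume a b)
    (a b : ℝ) : ∫ s in a..b, h s =
      (∫ s in a..b, (h s).re) • (1 : ℂ) + (∫ s in a..b, (h s).im) • Complex.I := by
  have hr : IntervalIntegrable (fun s => ((h s).re : ℂ)) volume a b :=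
    ⟨(hh a b).1.re.ofReal, (hh a b).2.re.ofReal⟩
  have hi : IntervalIntegrable (fun s => ((h s).im : ℂ)) volume a b :=
    ⟨(hh a b).1.im.ofReal, (hh a b).2.im.ofReal⟩
  rw [Complex.real_smul, Complex.real_smul, mul_one, ← intervalIntegral.integral_ofReal,
    ← intervalIntegral.integral_ofReal, ← intervalIntegral.integral_mul_const,
    ← intervalIntegral.integral_add hr (hi.mul_const _)]
  simp_rw [Complex.re_add_im]

theorem absolutelyContinuousOnInterval_intervalIntegral {h : ℝ → ℂ}
    (hh : ∀ a b, IntervalIntegrable h volume a b) (a b : ℝ) :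
    AbsolutelyContinuousOnInterval (fun t => ∫ s in a..t, h s) a b := by
  simp_rw [intervalIntegral_eq_re_add_im hh]
  have hr : IntervalIntegrable (fun s => (h s).re) volume a b :=
    ⟨(hh a b).1.re, (hh a b).2.re⟩
  have hi : IntervalIntegrable (fun s => (h s).im) volume a b :=
    ⟨(hh a b).1.im, (hh a b).2.im⟩
  have hc : ∀ z : ℂ, AbsolutelyContinuousOnInterval (fun _ : ℝ => z) a b := fun z =>
    contDiff_const.contDiffOn.absolutelyContinuousOnInterval
  exact ((hr.absolutelyContinuousOnInterval_intervalIntegral (by simp)).fun_smul (hc _)).fun_add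
    ((hi.absolutelyContinuousOnInterval_intervalIntegral (by simp)).fun_smul (hc _))

/-- The product of a smooth function and an indefinite integral is an indefinite integral. -/
theorem mul_intervalIntegral {e e' h : ℝ → ℂ} (he : ContDiff ℝ 1 e)
    (he' : ∀ t, HasDerivAt e (e' t) t) (hh : ∀ a b, IntervalIntegrable h volume a b) (c : ℂ)
    (t : ℝ) :
    e t * (c + ∫ s in (0 : ℝ)..t, h s) =
      e 0 * c + ∫ s in (0 : ℝ)..t, (e' s * (c + ∫ u in (0 : ℝ)..s, h u) + e s * h s) := by
  have he'c : Continuous e' := by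
    have : deriv e = e' := funext fun t => (he' t).deriv
    exact this ▸ he.continuous_deriv_one
  have hac := absolutelyContinuousOnInterval_intervalIntegral hh 0 t
  have hcont : Continuous fun s => ∫ u in (0 : ℝ)..s, h u :=
    intervalIntegral.continuous_primitive hh 0
  have hk : ∀ a b, IntervalIntegrable
      (fun s => e' s * (c + ∫ u in (0 : ℝ)..s, h u) + e s * h s) volume a b := fun a b =>
    ((he'c.mul (continuous_const.add hcont)).intervalIntegrable a b).add
      ((hh a b).continuousOn_mul he.continuous.continuousOn)
  have hconst : ∀ z : ℂ, AbsolutelyContinuousOnInterval (fun _ : ℝ => z) 0 t := fun z =>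
    contDiff_const.contDiffOn.absolutelyContinuousOnInterval
  -- Both sides are absolutely continuous with the same derivative almost everywhere, so their
  -- difference is constant and can be evaluated at `0`.
  have hF : AbsolutelyContinuousOnInterval (fun t => e t • (c + ∫ s in (0 : ℝ)..t, h s) -
      ∫ s in (0 : ℝ)..t, (e' s * (c + ∫ u in (0 : ℝ)..s, h u) + e s * h s)) 0 t :=
    (he.contDiffOn.absolutelyContinuousOnInterval.fun_smul ((hconst c).fun_add hac)).fun_sub
      (absolutelyContinuousOnInterval_intervalIntegral hk 0 t)
  obtain ⟨C, hC⟩ := hF.const_of_ae_hasDerivAt_zero (by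
    filter_upwards [(hh 0 t).ae_hasDerivAt_integral, (hk 0 t).ae_hasDerivAt_integral]
      with x h1 h2 hx
    have h3 := ((he' x).mul ((h1 hx 0 (by simp)).const_add c)).sub (h2 hx 0 (by simp))
    rw [sub_self] at h3
    exact h3)
  have h0 := hC 0 (by simp)
  have ht := hC t (by simp)
  rw [← h0] at ht
  simp only [smul_eq_mul, intervalIntegral.integral_same, add_zero, sub_zero] at ht
  rw [← ht]
  ring

end Time

/-! ### Duality of the forward and backward transition functions -/

section Reversal

variable {α β : Type*} [MeasurableSpace α] [MeasurableSpace β]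

/-- Two measures on a product space that agree on rectangles are equal if the first marginal
is σ-finite. -/
theorem measure_ext_of_rectangles {M N : Measure (α × β)} {μ : Measure α} [SigmaFinite μ]
    (hM : ∀ A, MeasurableSet A → M (A ×ˢ Set.univ) = μ A)
    (h : ∀ A B, MeasurableSet A → MeasurableSet B → M (A ×ˢ B) = N (A ×ˢ B)) : M = N := by
  refine Measure.ext_of_generateFrom_of_iUnion
    (Set.image2 (· ×ˢ ·) {s : Set α | MeasurableSet s} {t : Set β | MeasurableSet t})
    (fun i => spanningSets μ i ×ˢ Set.univ) generateFrom_prod.symm isPiSystem_prod ?_ ?_ ?_ ?_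
  · rw [← Set.iUnion_prod_const, iUnion_spanningSets, Set.univ_prod_univ]
  · exact fun i => ⟨_, measurableSet_spanningSets μ i, _, MeasurableSet.univ, rfl⟩
  · intro i
    rw [hM _ (measurableSet_spanningSets μ i)]
    exact (measure_spanningSets_lt_top μ i).ne
  · rintro _ ⟨A, hA, B, hB, rfl⟩
    exact h A B hA hB

theorem withDensity_compProd {ν : Measure α} [SFinite ν] {u : α → ℝ≥0∞} (hu : Measurable u)
    [SFinite (ν.withDensity u)] (κ : Kernel α β) [IsSFiniteKernel κ] :
    (ν.withDensity u) ⊗ₘ κ = (ν ⊗ₘ κ).withDensity fun z => u z.1 := by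
  refine Measure.ext_of_lintegral _ fun f hf => ?_
  rw [lintegral_withDensity_eq_lintegral_mul _ (by fun_prop) hf,
    Measure.lintegral_compProd hf, Measure.lintegral_compProd (by fun_prop),
    lintegral_withDensity_eq_lintegral_mul _ hu (by fun_prop)]
  refine lintegral_congr fun x => ?_
  simp only [Pi.mul_apply]
  rw [lintegral_const_mul _ (by fun_prop)]

/-- The right side minus the left side is `(u - v)² / ((1 + u)(1 + v))`: the function `a ↦ 1/(1+a)`
is strictly decreasing. -/
theorem exchange_inv_one_add_mul {u v : ℝ≥0} :
    (1 + v)⁻¹ * v + (1 + u)⁻¹ * u ≤ (1 + v)⁻¹ * u + (1 + u)⁻¹ * v ∧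
      ((1 + v)⁻¹ * v + (1 + u)⁻¹ * u = (1 + v)⁻¹ * u + (1 + u)⁻¹ * v → u = v) := by
  have key : ((1 + (v : ℝ))⁻¹ * u + (1 + (u : ℝ))⁻¹ * v) -
      ((1 + (v : ℝ))⁻¹ * v + (1 + (u : ℝ))⁻¹ * u)
      = ((u : ℝ) - v) ^ 2 / ((1 + u) * (1 + v)) := by
    field_simp
    ring
  constructor
  · rw [← NNReal.coe_le_coe]
    push_cast
    have : 0 ≤ ((u : ℝ) - v) ^ 2 / ((1 + u) * (1 + v)) := by positivity
    linarith
  · intro h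
    have h' := congrArg NNReal.toReal h
    push_cast at h'
    rw [h', sub_self, eq_comm, div_eq_zero_iff] at key
    rcases key with h1 | h1
    · exact NNReal.coe_injective (sub_eq_zero.1 (pow_eq_zero_iff two_ne_zero |>.1 h1))
    · exact absurd h1 (by positivity)

/-- If the densities `u(x)` and `v(y)` with respect to a finite measure on a product space give
measures with the same marginals, they agree almost everywhere. -/
theorem density_eq_of_marginals {J : Measure (α × β)} [IsFiniteMeasure J] {u : α → ℝ≥0∞}
    {v : β → ℝ≥0∞} (hu : Measurable u) (hv : Measurable v)
    (hu' : ∀ᵐ z ∂J, u z.1 < ∞) (hv' : ∀ᵐ z ∂J, v z.2 < ∞)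
    (h1 : (J.withDensity fun z => u z.1).map Prod.fst = (J.withDensity fun z => v z.2).map Prod.fst)
    (h2 : (J.withDensity fun z => u z.1).map Prod.snd =
      (J.withDensity fun z => v z.2).map Prod.snd) :
    (fun z => u z.1) =ᵐ[J] fun z => v z.2 := by
  -- The common first marginal is tested with `1/(1+u)`; below, the second is tested with `1/(1+v)`.
  -- These weights keep the integrals finite although `u` and `v` need not be integrable.
  have e1 : ∫⁻ z, (1 + u z.1)⁻¹ * v z.2 ∂J = ∫⁻ z, (1 + u z.1)⁻¹ * u z.1 ∂J := by
    have h : ∫⁻ x, (1 + u x)⁻¹ ∂((J.withDensity fun z => u z.1).map Prod.fst)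
        = ∫⁻ x, (1 + u x)⁻¹ ∂((J.withDensity fun z => v z.2).map Prod.fst) := by rw [h1]
    rw [lintegral_map (by fun_prop) measurable_fst, lintegral_map (by fun_prop) measurable_fst,
      lintegral_withDensity_eq_lintegral_mul _ (by fun_prop) (by fun_prop),
      lintegral_withDensity_eq_lintegral_mul _ (by fun_prop) (by fun_prop)] at h
    simpa only [Pi.mul_apply, mul_comm] using h.symm
  have e2 : ∫⁻ z, (1 + v z.2)⁻¹ * u z.1 ∂J = ∫⁻ z, (1 + v z.2)⁻¹ * v z.2 ∂J := by
    have h : ∫⁻ x, (1 + v x)⁻¹ ∂((J.withDensity fun z => u z.1).map Prod.snd)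
        = ∫⁻ x, (1 + v x)⁻¹ ∂((J.withDensity fun z => v z.2).map Prod.snd) := by rw [h2]
    rw [lintegral_map (by fun_prop) measurable_snd, lintegral_map (by fun_prop) measurable_snd,
      lintegral_withDensity_eq_lintegral_mul _ (by fun_prop) (by fun_prop),
      lintegral_withDensity_eq_lintegral_mul _ (by fun_prop) (by fun_prop)] at h
    simpa only [Pi.mul_apply, mul_comm] using h
  have hbound : ∀ a : ℝ≥0∞, (1 + a)⁻¹ * a ≤ 1 := fun a => by
    calc (1 + a)⁻¹ * a ≤ (1 + a)⁻¹ * (1 + a) := by gcongr; exact le_add_self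
      _ ≤ 1 := ENNReal.inv_mul_le_one _
  have hfin : ∫⁻ z, ((1 + v z.2)⁻¹ * v z.2 + (1 + u z.1)⁻¹ * u z.1) ∂J ≠ ∞ := by
    refine ne_top_of_le_ne_top (b := ∫⁻ _, 2 ∂J) (by simp [ENNReal.mul_eq_top]) ?_
    refine lintegral_mono fun z => ?_
    calc _ ≤ (1 : ℝ≥0∞) + 1 := add_le_add (hbound _) (hbound _)
      _ = 2 := one_add_one_eq_two
  -- The pointwise inequality of `exchange_inv_one_add_mul` thus has equal integrals, so it is an
  -- equality almost everywhere.
  have hle : ∫⁻ z, ((1 + v z.2)⁻¹ * u z.1 + (1 + u z.1)⁻¹ * v z.2) ∂J ≤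
      ∫⁻ z, ((1 + v z.2)⁻¹ * v z.2 + (1 + u z.1)⁻¹ * u z.1) ∂J := by
    rw [lintegral_add_left (by fun_prop), lintegral_add_left (by fun_prop), e1, e2]
  have hcoe : ∀ a b : ℝ≥0, (1 + (a : ℝ≥0∞))⁻¹ * (b : ℝ≥0∞) = ((1 + a)⁻¹ * b : ℝ≥0) :=
    fun a b => by
      rw [ENNReal.coe_mul, ENNReal.coe_inv (by positivity)]
      simp
  have hae := ae_eq_of_ae_le_of_lintegral_le (μ := J)
    (f := fun z => (1 + v z.2)⁻¹ * v z.2 + (1 + u z.1)⁻¹ * u z.1)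
    (g := fun z => (1 + v z.2)⁻¹ * u z.1 + (1 + u z.1)⁻¹ * v z.2) (by
      filter_upwards [hu', hv'] with z h3 h4
      lift u z.1 to ℝ≥0 using h3.ne with a
      lift v z.2 to ℝ≥0 using h4.ne with b
      simp only [hcoe, ← ENNReal.coe_add, ENNReal.coe_le_coe]
      exact exchange_inv_one_add_mul.1) hfin (by fun_prop) hle
  filter_upwards [hu', hv', hae] with z h3 h4 h5
  revert h5
  lift u z.1 to ℝ≥0 using h3.ne with a
  lift v z.2 to ℝ≥0 using h4.ne with b
  simp only [hcoe, ← ENNReal.coe_add, ENNReal.coe_inj]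
  exact exchange_inv_one_add_mul.2

variable {Ω : Type*} [MeasurableSpace Ω] {P : Measure Ω} {X : ℝ → Ω → α}
  {p q : ℝ≥0 → Kernel α α}

theorem map_pair_eq_forward [∀ t, IsMarkovKernel (p t)]
    (hX : IsBilateralMarkov P X p q) (s : ℝ) (t : ℝ≥0)
    [SigmaFinite (P.map (X s))] :
    P.map (fun ω => (X s ω, X (s + t) ω)) = P.map (X s) ⊗ₘ p t := by
  have hm := hX.measurable
  have hrect : ∀ A B, MeasurableSet A → MeasurableSet B →
      P.map (fun ω => (X s ω, X (s + t) ω)) (A ×ˢ B) = (P.map (X s) ⊗ₘ p t) (A ×ˢ B) := by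
    intro A B hA hB
    -- The event `X s ∈ A` belongs to the past up to `s` since the half-line `Iic s` includes `s`
    -- itself.
    have h := hX.forward s t (X s ⁻¹' A) B
      (le_iSup (fun u : Set.Iic s => MeasurableSpace.comap (X u) inferInstance)
        ⟨s, Set.mem_Iic.2 le_rfl⟩ _ ⟨A, hA, rfl⟩) hB
    rw [Measure.map_apply (by fun_prop) (hA.prod hB), Measure.compProd_apply_prod hA hB,
      setLIntegral_map hA (Kernel.measurable_coe _ hB) (hm s), ← h]
    rfl
  refine (measure_ext_of_rectangles (μ := P.map (X s)) (fun A hA => ?_) hrect)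
  rw [Measure.map_apply (by fun_prop) (hA.prod .univ), Measure.map_apply (hm s) hA]
  congr 1
  ext ω
  simp

theorem map_pair_eq_backward [∀ t, IsMarkovKernel (q t)]
    (hX : IsBilateralMarkov P X p q) (s : ℝ) (t : ℝ≥0)
    [SigmaFinite (P.map (X (s + t)))] :
    P.map (fun ω => (X (s + t) ω, X s ω)) = P.map (X (s + t)) ⊗ₘ q t := by
  have hm := hX.measurable
  have hrect : ∀ A B, MeasurableSet A → MeasurableSet B →
      P.map (fun ω => (X (s + t) ω, X s ω)) (A ×ˢ B) = (P.map (X (s + t)) ⊗ₘ q t) (A ×ˢ B) := by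
    intro A B hA hB
    have h := hX.backward (s + t) t (X (s + t) ⁻¹' A) B
      (le_iSup (fun u : Set.Ici (s + (t : ℝ)) => MeasurableSpace.comap (X u) inferInstance)
        ⟨s + t, Set.mem_Ici.2 le_rfl⟩ _ ⟨A, hA, rfl⟩) hB
    rw [add_sub_cancel_right] at h
    rw [Measure.map_apply (by fun_prop) (hA.prod hB), Measure.compProd_apply_prod hA hB,
      setLIntegral_map hA (Kernel.measurable_coe _ hB) (hm _), ← h]
    rfl
  refine (measure_ext_of_rectangles (μ := P.map (X (s + t))) (fun A hA => ?_) hrect)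
  rw [Measure.map_apply (by fun_prop) (hA.prod .univ), Measure.map_apply (hm _) hA]
  congr 1
  ext ω
  simp

/-- The transition functions of a bilateral Markov process are in duality with respect to an
invariant measure. -/
theorem compProd_map_swap [∀ t, IsMarkovKernel (p t)] [∀ t, IsMarkovKernel (q t)]
    (hX : IsBilateralMarkov P X p q) {μ : Measure α} [SigmaFinite μ]
    (hμ : IsInvariantMeasure P X p q μ) (t : ℝ≥0) :
    (μ ⊗ₘ p t).map Prod.swap = μ ⊗ₘ q t := by
  have hm := hX.measurable
  have hswap : (P.map (fun ω => (X 0 ω, X (0 + t) ω))).map Prod.swap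
      = P.map (fun ω => (X (0 + t) ω, X 0 ω)) := by
    rw [Measure.map_map measurable_swap (by fun_prop)]
    rfl
  rcases hμ.proper_or_improper with ⟨hP, hac⟩ | himp
  · have hfin : ∀ s, IsProbabilityMeasure (P.map (X s)) := fun s =>
      Measure.isProbabilityMeasure_map (hm s).aemeasurable
    have hd : ∀ s, (P.map (X s)).withDensity (μ.rnDeriv (P.map (X s))) = μ := fun s =>
      Measure.withDensity_rnDeriv_eq _ _ (hac s)
    have hsf : ∀ s, SFinite ((P.map (X s)).withDensity (μ.rnDeriv (P.map (X s)))) := fun s => by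
      rw [hd]; infer_instance
    have hp := withDensity_compProd (ν := P.map (X 0))
      (Measure.measurable_rnDeriv μ (P.map (X 0))) (p t)
    have hq := withDensity_compProd (ν := P.map (X (0 + t)))
      (Measure.measurable_rnDeriv μ (P.map (X (0 + t)))) (q t)
    rw [hd, ← map_pair_eq_forward hX] at hp
    rw [hd, ← map_pair_eq_backward hX] at hq
    set u := μ.rnDeriv (P.map (X 0)) with hu_def
    set v := μ.rnDeriv (P.map (X (0 + t))) with hv_def
    have hu : Measurable u := Measure.measurable_rnDeriv _ _
    have hv : Measurable v := Measure.measurable_rnDeriv _ _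
    set J := P.map (fun ω => (X 0 ω, X (0 + t) ω)) with hJ
    have hJfin : IsProbabilityMeasure J :=
      Measure.isProbabilityMeasure_map (by fun_prop)
    have hN : (J.withDensity fun z => v z.2).map Prod.swap = μ ⊗ₘ q t := by
      rw [hq, ← hswap]
      refine Measure.ext_of_lintegral _ fun f hf => ?_
      rw [lintegral_map hf measurable_swap,
        lintegral_withDensity_eq_lintegral_mul _ (by fun_prop) (by fun_prop),
        lintegral_withDensity_eq_lintegral_mul _ (by fun_prop) hf,
        lintegral_map (by fun_prop) measurable_swap]
      rfl
    have hN' : J.withDensity (fun z => v z.2) = (μ ⊗ₘ q t).map Prod.swap := by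
      rw [← hN, Measure.map_map measurable_swap measurable_swap, Prod.swap_swap_eq, Measure.map_id]
    have hsnd : ∀ (κ : Kernel α α) [IsMarkovKernel κ], κ.Invariant μ →
        (μ ⊗ₘ κ).map Prod.snd = μ := fun κ _ hκ => by
      have := Measure.snd_compProd μ κ
      rw [hκ.def] at this
      exact this
    have hfst : ∀ (κ : Kernel α α) [IsMarkovKernel κ], (μ ⊗ₘ κ).map Prod.fst = μ := fun κ _ =>
      Measure.fst_compProd μ κ
    -- Each marginal is `μ`, either as the base measure of a composition product or by invariance of
    -- the kernel.
    have hae : (fun z => u z.1) =ᵐ[J] fun z => v z.2 := by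
      refine density_eq_of_marginals hu hv ?_ ?_ ?_ ?_
      · have := Measure.rnDeriv_lt_top μ (P.map (X 0))
        rw [hJ, ae_map_iff (by fun_prop) (measurableSet_lt (by fun_prop) (by fun_prop))]
        exact ae_of_ae_map (hm 0).aemeasurable this
      · have := Measure.rnDeriv_lt_top μ (P.map (X (0 + t)))
        rw [hJ, ae_map_iff (by fun_prop) (measurableSet_lt (by fun_prop) (by fun_prop))]
        exact ae_of_ae_map (hm (0 + t)).aemeasurable this
      · rw [← hp, hN', hfst, Measure.map_map measurable_fst measurable_swap]
        exact (hsnd (q t) (hμ.backward t)).symm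
      · rw [← hp, hN', hsnd _ (hμ.forward t), Measure.map_map measurable_snd measurable_swap]
        exact (hfst (q t)).symm
    rw [← hN, hp, withDensity_congr_ae hae]
  · have hfin : ∀ s, SigmaFinite (P.map (X s)) := fun s => by rw [himp]; infer_instance
    have hp := map_pair_eq_forward hX 0 t
    have hq := map_pair_eq_backward hX 0 t
    rw [himp] at hp hq
    rw [← hp, ← hq, hswap]

end Reversal

/-! ### Adjointness of the transition operators -/

section TransitionDuality

variable {α : Type*} [MeasurableSpace α] {μ : Measure α}

theorem coeFn_transitionOp {κ : Kernel α α} [IsMarkovKernel κ] (hκ : κ.Invariant μ)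
    (f : Lp ℂ 2 μ) : transitionOp κ μ hκ f =ᵐ[μ] fun x => ∫ y, f y ∂κ x :=
  (memLp_kernel_integral κ μ hκ f).coeFn_toLp

theorem transitionOp_one [IsFiniteMeasure μ] {κ : Kernel α α} [IsMarkovKernel κ]
    (hκ : κ.Invariant μ) :
    transitionOp κ μ hκ ((memLp_const (1 : ℂ)).toLp _) = (memLp_const (1 : ℂ)).toLp _ := by
  refine Lp.ext ?_
  have h1 : ((memLp_const (1 : ℂ)).toLp _ : Lp ℂ 2 μ) =ᵐ[μ] fun _ => (1 : ℂ) := MemLp.coeFn_toLp _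
  filter_upwards [coeFn_transitionOp hκ ((memLp_const (1 : ℂ)).toLp _), h1,
    ae_ae_of_invariant κ μ hκ h1] with x h2 h3 h4
  rw [h2, h3, integral_congr_ae h4]
  simp

variable [SFinite μ]

/-- Both marginals of `μ ⊗ₘ κ` are `μ`, the second by invariance, so both factors are square
integrable. -/
theorem integrable_compProd_mul {κ : Kernel α α} [IsMarkovKernel κ] (hκ : κ.Invariant μ)
    (f g : Lp ℂ 2 μ) :
    Integrable (fun z : α × α => (starRingEnd ℂ) (f z.1) * g z.2) (μ ⊗ₘ κ) := by
  have h1 : MemLp (fun z : α × α => f z.1) 2 (μ ⊗ₘ κ) := by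
    refine (Lp.memLp f).comp_measurePreserving ⟨measurable_fst, ?_⟩
    exact Measure.fst_compProd μ κ
  have h2 : MemLp (fun z : α × α => g z.2) 2 (μ ⊗ₘ κ) := by
    refine (Lp.memLp g).comp_measurePreserving ⟨measurable_snd, ?_⟩
    have := Measure.snd_compProd μ κ
    rwa [hκ.def] at this
  exact h1.star.integrable_mul h2

theorem inner_transitionOp {κ : Kernel α α} [IsMarkovKernel κ] (hκ : κ.Invariant μ)
    (f g : Lp ℂ 2 μ) : inner ℂ f (transitionOp κ μ hκ g) =
      ∫ z, (starRingEnd ℂ) (f z.1) * g z.2 ∂(μ ⊗ₘ κ) := by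
  rw [L2.inner_def, Measure.integral_compProd (integrable_compProd_mul hκ f g)]
  refine integral_congr_ae ?_
  filter_upwards [coeFn_transitionOp hκ g] with x hx
  rw [hx, integral_const_mul, RCLike.inner_apply, mul_comm]

theorem transitionOp_duality {κ η : Kernel α α} [IsMarkovKernel κ] [IsMarkovKernel η]
    (hκ : κ.Invariant μ) (hη : η.Invariant μ) (h : (μ ⊗ₘ κ).map Prod.swap = μ ⊗ₘ η)
    (f g : Lp ℂ 2 μ) :
    inner ℂ (transitionOp η μ hη f) g = inner ℂ f (transitionOp κ μ hκ g) := by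
  have hswap : MeasurableEmbedding (Prod.swap : α × α → α × α) :=
    MeasurableEquiv.prodComm.measurableEmbedding
  rw [← inner_conj_symm, inner_transitionOp, inner_transitionOp, ← h, hswap.integral_map,
    ← integral_conj]
  refine integral_congr_ae (ae_of_all _ fun z => ?_)
  simp [mul_comm]

end TransitionDuality

/-! ### The space-time semigroup on product functions -/

section SpaceTime

variable {α : Type*} [MeasurableSpace α] {μ : Measure α} [SFinite μ]

theorem transitionOp_spaceTimeKernel {κ : Kernel α α} [IsMarkovKernel κ] (hκ : κ.Invariant μ)
    (r : ℝ) (f : Lp ℂ 2 μ) (g : Lp ℂ 2 (volume : Measure ℝ)) :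
    transitionOp (spaceTimeKernel κ r) (μ.prod volume) (spaceTimeKernel_invariant hκ r)
      (tensorLp f g) = tensorLp (transitionOp κ μ hκ f) (timeShift r g) := by
  refine Lp.ext ?_
  filter_upwards [coeFn_transitionOp (spaceTimeKernel_invariant hκ r) (tensorLp f g),
    coeFn_tensorLp (transitionOp κ μ hκ f) (timeShift r g),
    ae_prod_fst (ν := (volume : Measure ℝ)) (coeFn_transitionOp hκ f),
    ae_prod_snd (μ := μ) (coeFn_timeShift r g),
    ae_ae_of_invariant _ _ (spaceTimeKernel_invariant hκ r) (coeFn_tensorLp f g)]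
    with z h1 h2 h3 h4 h5
  rw [h1, h2, h3, h4, integral_congr_ae h5, spaceTimeKernel, Kernel.parallelComp_apply,
    integral_prod_mul, Kernel.deterministic_apply, integral_dirac]

/-- The space-time generator on product functions. -/
theorem mem_graph_spaceTime {p : ℝ≥0 → Kernel α α} [∀ t, IsMarkovKernel (p t)]
    (hp : ∀ t, (p t).Invariant μ) {σ : ℝ} (hσ : σ ≠ 0) {f a : Lp ℂ 2 μ}
    (hf : (f, a) ∈ (markovGenerator p μ hp).graph) {g h : Lp ℂ 2 (volume : Measure ℝ)}
    (hg : (g, h) ∈ timeDeriv.graph) :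
    Tendsto (fun t : ℝ≥0 => ((t : ℝ) : ℂ)⁻¹ • (transitionOp (spaceTimeKernel (p t) (σ * t))
      (μ.prod volume) (spaceTimeKernel_invariant (hp t) (σ * t)) (tensorLp f g) - tensorLp f g))
      (𝓝[>] 0) (𝓝 (tensorLp a g + (σ : ℂ) • tensorLp f h)) := by
  have hf' := mem_graph_generator.1 hf
  rw [timeDeriv_graph] at hg
  have hcoe : Tendsto (fun t : ℝ≥0 => σ * (t : ℝ)) (𝓝[>] 0) (𝓝[≠] 0) := by
    refine tendsto_nhdsWithin_iff.2 ⟨?_, ?_⟩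
    · have : Continuous fun t : ℝ≥0 => σ * (t : ℝ) := by fun_prop
      simpa using (this.tendsto 0).mono_left nhdsWithin_le_nhds
    · filter_upwards [self_mem_nhdsWithin] with t ht
      have : (t : ℝ) ≠ 0 := by exact_mod_cast (ne_of_gt ht)
      simp [hσ, this]
  have hshift : Tendsto (fun t : ℝ≥0 => timeShift (σ * t) g) (𝓝[>] 0) (𝓝 g) := by
    have := ((continuous_timeShift g).tendsto 0).comp (hcoe.mono_right nhdsWithin_le_nhds)
    rwa [timeShift_zero] at this
  -- With `S` the time shift by `σt`, the increment splits as `(T f - f) ⊗ S g + f ⊗ (S g - g)`.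
  -- Quotients of the second term have step `σt`, whence the factor `σ`.
  have hquot := ((tendsto_differenceQuotient hg).comp hcoe).const_smul (σ : ℂ)
  have h1 := (continuous_tensorLp.tendsto (a, g)).comp (hf'.prodMk_nhds hshift)
  have h2 := (continuous_tensorLp.tendsto (f, (σ : ℂ) • h)).comp
    (tendsto_const_nhds.prodMk_nhds hquot)
  have e : tensorLp f ((σ : ℂ) • h) = (σ : ℂ) • tensorLp f h := by
    rw [← tensorBilin_apply, map_smul, tensorBilin_apply]
  have h3 := h1.add h2
  simp only [e] at h3
  refine h3.congr' ?_
  filter_upwards [self_mem_nhdsWithin] with t ht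
  have ht0 : ((t : ℝ) : ℂ) ≠ 0 := by
    have : (t : ℝ) ≠ 0 := by exact_mod_cast (ne_of_gt ht)
    exact_mod_cast this
  have hσ' : (σ : ℂ) ≠ 0 := by exact_mod_cast hσ
  rw [transitionOp_spaceTimeKernel (hp t)]
  simp only [Function.comp_apply, ← tensorBilin_apply, map_smul, map_sub, LinearMap.smul_apply,
    LinearMap.sub_apply, smul_smul]
  have : (σ : ℂ) * ((σ * (t : ℝ) : ℝ) : ℂ)⁻¹ = ((t : ℝ) : ℂ)⁻¹ := by
    push_cast
    field_simp
  rw [this]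
  module

end SpaceTime

/-! ### Multiplication operators and phases -/

section Weights

variable {α : Type*} [MeasurableSpace α] {ν μ : Measure α} {w : α → ℂ}

theorem coeFn_mulIsometry (hw : Measurable w) (h : μ = ν.withDensity fun x => ‖w x‖ₑ ^ 2)
    (f : Lp ℂ 2 μ) : mulIsometry hw h f =ᵐ[ν] fun x => f x * w x :=
  (memLp_mul_weight hw h f).coeFn_toLp

theorem mulIsometry_toLp (hw : Measurable w) (h : μ = ν.withDensity fun x => ‖w x‖ₑ ^ 2)
    {f : α → ℂ} (hf : MemLp f 2 μ) {g : α → ℂ} (hg : MemLp g 2 ν)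
    (hfg : ∀ᵐ x ∂ν, f x * w x = g x) : mulIsometry hw h (hf.toLp f) = hg.toLp g := by
  refine Lp.ext ?_
  filter_upwards [coeFn_mulIsometry hw h (hf.toLp f), ae_weight hw h hf.coeFn_toLp,
    hg.coeFn_toLp, hfg] with x h1 h2 h3 h4
  rw [h1, h2, h3, h4]

/-- Division by `w` provides the preimage. Unitarity is what carries density of the domain over to
`L²(dx)`. -/
theorem mulIsometry_surjective (hw : Measurable w) (h : μ = ν.withDensity fun x => ‖w x‖ₑ ^ 2)
    (hw0 : ∀ᵐ x ∂ν, w x ≠ 0) : Function.Surjective (mulIsometry hw h) := by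
  intro F
  have hF := Lp.stronglyMeasurable F
  have hm : StronglyMeasurable fun x => F x / w x :=
    (hF.measurable.div hw).stronglyMeasurable
  have hf : MemLp (fun x => F x / w x) 2 μ := by
    rw [memLp_two_iff_lintegral hm.aestronglyMeasurable, h,
      lintegral_withDensity_eq_lintegral_mul _ (by fun_prop) (by fun_prop)]
    refine lt_of_eq_of_lt (lintegral_congr_ae ?_)
      ((memLp_two_iff_lintegral hF.aestronglyMeasurable).1 (Lp.memLp F))
    filter_upwards [hw0] with x hx
    rw [Pi.mul_apply, ← mul_pow, ← enorm_mul, mul_div_cancel₀ _ hx]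
  refine ⟨hf.toLp _, ?_⟩
  rw [mulIsometry_toLp hw h hf (Lp.memLp F), Lp.toLp_coeFn]
  filter_upwards [hw0] with x hx
  rw [div_mul_cancel₀ _ hx]

end Weights

/-! ### The phase `e^{-iEt}` acting on `H¹` -/

section Phase

/-- The phase `e^{-iEt}`. -/
def phase (E : ℝ) (t : ℝ) : ℂ := Complex.exp (-(Complex.I * (E : ℂ) * (t : ℂ)))

theorem measurable_phase (E : ℝ) : Measurable (phase E) := by
  unfold phase; fun_prop

theorem enorm_phase (E t : ℝ) : ‖phase E t‖ₑ = 1 := by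
  have : -(Complex.I * (E : ℂ) * (t : ℂ)) = ((-(E * t) : ℝ) : ℂ) * Complex.I := by
    push_cast; ring
  rw [← ofReal_norm, phase, this, Complex.norm_exp_ofReal_mul_I, ENNReal.ofReal_one]

theorem volume_eq_phase (E : ℝ) :
    (volume : Measure ℝ) = volume.withDensity fun t => ‖phase E t‖ₑ ^ 2 := by
  simp_rw [enorm_phase, one_pow]
  exact withDensity_one.symm

theorem hasDerivAt_phase (E t : ℝ) :
    HasDerivAt (phase E) (-(Complex.I * E) * phase E t) t := by
  have h1 : HasDerivAt (fun t : ℝ => -(Complex.I * (E : ℂ) * (t : ℂ))) (-(Complex.I * E)) t := by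
    have := (Complex.ofRealCLM.hasDerivAt (x := t)).const_mul (-(Complex.I * (E : ℂ)))
    simpa using this
  exact h1.cexp.congr_deriv (mul_comm _ _)

theorem contDiff_phase (E : ℝ) : ContDiff ℝ 1 (phase E) := by
  unfold phase
  have : ContDiff ℝ 1 fun t : ℝ => (t : ℂ) := Complex.ofRealCLM.contDiff
  fun_prop

/-- Multiplication by the phase `e^{-iEt}` on `L²(ℝ)`. -/
def phaseOp (E : ℝ) : Lp ℂ 2 (volume : Measure ℝ) →ₗᵢ[ℂ] Lp ℂ 2 (volume : Measure ℝ) :=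
  mulIsometry (measurable_phase E) (volume_eq_phase E)

theorem coeFn_phaseOp (E : ℝ) (g : Lp ℂ 2 (volume : Measure ℝ)) :
    phaseOp E g =ᵐ[volume] fun t => g t * phase E t :=
  coeFn_mulIsometry _ _ g

theorem phaseOp_phaseOp_neg (E : ℝ) (g : Lp ℂ 2 (volume : Measure ℝ)) :
    phaseOp E (phaseOp (-E) g) = g := by
  refine Lp.ext ?_
  filter_upwards [coeFn_phaseOp E (phaseOp (-E) g), coeFn_phaseOp (-E) g] with t h1 h2
  rw [h1, h2, mul_assoc, phase, phase, ← Complex.exp_add]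
  simp

/-- The phase preserves `H¹`. -/
theorem mem_graph_timeDeriv_phaseOp (E : ℝ) {g h : Lp ℂ 2 (volume : Measure ℝ)}
    (hgh : (g, h) ∈ timeDeriv.graph) :
    (phaseOp E g, phaseOp E h - (Complex.I * E) • phaseOp E g) ∈ timeDeriv.graph := by
  rw [timeDeriv_graph] at hgh ⊢
  obtain ⟨c, hc⟩ := mem_timeDerivGraph.1 hgh
  refine mem_timeDerivGraph.2 ⟨phase E 0 * c, ?_⟩
  have hint : ∀ t : ℝ, ∫ s in (0 : ℝ)..t,
      (phaseOp E h - (Complex.I * E) • phaseOp E g : Lp ℂ 2 (volume : Measure ℝ)) s =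
      ∫ s in (0 : ℝ)..t, (-(Complex.I * E) * phase E s * (c + ∫ u in (0 : ℝ)..s, h u)
        + phase E s * h s) := fun t => by
    refine intervalIntegral.integral_congr_ae ?_
    filter_upwards [hc, coeFn_phaseOp E g, coeFn_phaseOp E h,
      Lp.coeFn_sub (phaseOp E h) ((Complex.I * E) • phaseOp E g),
      Lp.coeFn_smul (Complex.I * (E : ℂ)) (phaseOp E g)] with s h1 h2 h3 h4 h5 _
    rw [h4, Pi.sub_apply, h5, Pi.smul_apply, h2, h3, h1, smul_eq_mul]
    ring
  filter_upwards [hc, coeFn_phaseOp E g] with t h1 h2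
  rw [h2, h1, hint, ← mul_intervalIntegral (contDiff_phase E) (hasDerivAt_phase E)
    (intervalIntegrable_Lp h), mul_comm]

end Phase

/-! ### The Hamiltonian -/

section TransportForm

variable {H H' : Type*} [NormedAddCommGroup H] [InnerProductSpace ℂ H]
  [NormedAddCommGroup H'] [InnerProductSpace ℂ H']

/-- Unitary transport and a real shift preserve symmetry and semiboundedness. -/
theorem isSymmetricSemibounded_transport_add {K : H →ₗ.[ℂ] H} (hK : IsSymmetricSemibounded K)
    {U : H →ₗᵢ[ℂ] H'} (hU : Function.Surjective U) (E : ℝ) :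
    IsSymmetricSemibounded (transport U K + (E : ℂ) • idOp H') := by
  have hx : ∀ x : (transport U K + (E : ℂ) • idOp H').domain, ∃ k : K.domain, U k = x ∧
      (transport U K + (E : ℂ) • idOp H') x = U (K k) + (E : ℂ) • U k := fun x => by
    obtain ⟨a, b, hab, ha, hb⟩ :=
      exists_of_mem_graph_transport ((transport U K).mem_graph ⟨x, x.2.1⟩)
    obtain ⟨k, rfl, rfl⟩ := (LinearPMap.mem_graph_iff _).1 hab
    refine ⟨k, ha, ?_⟩
    rw [LinearPMap.add_apply, ← hb, ha]
    rfl
  refine ⟨?_, fun x y => ?_, ?_⟩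
  · have hdom : (transport U K + (E : ℂ) • idOp H').domain = K.domain.map U.toLinearMap := by
      rw [LinearPMap.add_domain, transport_domain]
      exact inf_top_eq _
    rw [hdom]
    exact hU.denseRange.dense_image U.continuous hK.dense
  · obtain ⟨k, hk, hk'⟩ := hx x
    obtain ⟨l, hl, hl'⟩ := hx y
    rw [hk', hl', ← hk, ← hl]
    simp only [inner_add_left, inner_add_right, inner_smul_left, inner_smul_right,
      U.inner_map_map, Complex.conj_ofReal]
    rw [hK.symmetric]
  · obtain ⟨c, hc⟩ := hK.boundedBelow
    refine ⟨c + E, fun x => ?_⟩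
    obtain ⟨k, hk, hk'⟩ := hx x
    have h := hc k
    have h3 : ‖(k : H)‖ ^ 2 = (inner ℂ (k : H) (k : H)).re := norm_sq_eq_re_inner (𝕜 := ℂ) _
    rw [hk', ← hk]
    simp only [inner_add_right, inner_smul_right, U.inner_map_map, Complex.add_re,
      Complex.re_ofReal_mul, U.norm_map]
    rw [← h3]
    linarith

theorem mem_graph_transport_add {K : H →ₗ.[ℂ] H} {U : H →ₗᵢ[ℂ] H'} (E : ℝ) {f k : H}
    (h : (f, k) ∈ K.graph) :
    (U f, U k + (E : ℂ) • U f) ∈ (transport U K + (E : ℂ) • idOp H').graph :=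
  mem_graph_add (mem_graph_transport h) (mem_graph_smul _ (mem_graph_idOp _))

end TransportForm

variable {n : ℕ}

/-! ### The space-time operator identity -/

section Hamiltonian

variable (p q : ℝ≥0 → Kernel (Space n) (Space n))
  [∀ t, IsMarkovKernel (p t)] [∀ t, IsMarkovKernel (q t)]
  {ρ S : Space n → ℝ} (hρ : Measurable ρ) (hS : Measurable S) (E : ℝ)
  (hp : ∀ t, (p t).Invariant (densityMeasure ρ)) (hq : ∀ t, (q t).Invariant (densityMeasure ρ))

theorem hamiltonian₀_domain : (hamiltonian₀ p q hρ hS E hp hq).domain =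
    ((markovGenerator p (densityMeasure ρ) hp).domain ⊓
      (markovGenerator q (densityMeasure ρ) hq).domain).map
        (mulIsometry (measurable_waveψ hρ hS) (density_eq_ψ ρ S)).toLinearMap := by
  rw [hamiltonian₀, LinearPMap.add_domain, doobReduced, transport_domain, symmetrize_domain]
  exact inf_top_eq _

theorem mulIsometry_tensorLp (f : Lp ℂ 2 (densityMeasure ρ)) (g : Lp ℂ 2 (volume : Measure ℝ)) :
    mulIsometry (measurable_waveΨ hρ hS E) (density_eq_Ψ hρ S E) (tensorLp f g) =
      tensorLp (mulIsometry (measurable_waveψ hρ hS) (density_eq_ψ ρ S) f) (phaseOp E g) := by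
  refine Lp.ext ?_
  filter_upwards [coeFn_mulIsometry (measurable_waveΨ hρ hS E) (density_eq_Ψ hρ S E)
      (tensorLp f g),
    ae_weight (measurable_waveΨ hρ hS E) (density_eq_Ψ hρ S E) (coeFn_tensorLp f g),
    coeFn_tensorLp (mulIsometry (measurable_waveψ hρ hS) (density_eq_ψ ρ S) f) (phaseOp E g),
    ae_prod_fst (ν := (volume : Measure ℝ))
      (coeFn_mulIsometry (measurable_waveψ hρ hS) (density_eq_ψ ρ S) f),
    ae_prod_snd (μ := (volume : Measure (Space n))) (coeFn_phaseOp E g)] with z h1 h2 h3 h4 h5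
  rw [h1, h2, h3, h4, h5, waveΨ, phase]
  ring

/-- Since `-i(-iE) = -E`, the two `E` terms cancel, and `(i-1)/(i+1) = i` matches the coefficients
of `f ⊗ k`. Here `h` stands for `e^{-iEt} g` and `k` for `e^{-iEt} g'`. -/
theorem tensorLp_symmetrize_identity {α β : Type*} [MeasurableSpace α] [MeasurableSpace β]
    {μ : Measure α} {ν : Measure β} [SFinite ν] (a b f : Lp ℂ 2 μ) (h k : Lp ℂ 2 ν) (E : ℂ) :
    tensorLp (-((Complex.I + 1)⁻¹ • (b + Complex.I • a)) + E • f) h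
      - Complex.I • tensorLp f (k - (Complex.I * E) • h) =
    -((Complex.I + 1)⁻¹ • (tensorLp b h - tensorLp f k
      + Complex.I • (tensorLp a h + tensorLp f k))) := by
  simp only [← tensorBilin_apply, map_neg, map_smul, map_add, map_sub, LinearMap.neg_apply,
    LinearMap.smul_apply, LinearMap.add_apply, inv_I_add_one]
  match_scalars <;> ring_nf <;> simp only [Complex.I_sq] <;> ring

variable {p} in
theorem mem_graph_spaceTimeForward {f a : Lp ℂ 2 (densityMeasure ρ)}
    (hf : (f, a) ∈ (markovGenerator p (densityMeasure ρ) hp).graph)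
    {g h : Lp ℂ 2 (volume : Measure ℝ)} (hg : (g, h) ∈ timeDeriv.graph) :
    (tensorLp f g, tensorLp a g + tensorLp f h) ∈
      (spaceTimeForward p (densityMeasure ρ) hp).graph := by
  refine mem_graph_domRestrict (Submodule.subset_span ⟨f, LinearPMap.mem_domain_of_mem_graph hf,
    g, LinearPMap.mem_domain_of_mem_graph hg, rfl⟩) (mem_graph_generator.2 ?_)
  have := mem_graph_spaceTime hp one_ne_zero hf hg
  simpa using this

variable {q} in
theorem mem_graph_spaceTimeBackward {f b : Lp ℂ 2 (densityMeasure ρ)}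
    (hf : (f, b) ∈ (markovGenerator q (densityMeasure ρ) hq).graph)
    {g h : Lp ℂ 2 (volume : Measure ℝ)} (hg : (g, h) ∈ timeDeriv.graph) :
    (tensorLp f g, tensorLp b g - tensorLp f h) ∈
      (spaceTimeBackward q (densityMeasure ρ) hq).graph := by
  refine mem_graph_domRestrict (Submodule.subset_span ⟨f, LinearPMap.mem_domain_of_mem_graph hf,
    g, LinearPMap.mem_domain_of_mem_graph hg, rfl⟩) (mem_graph_generator.2 ?_)
  have := mem_graph_spaceTime hq (neg_ne_zero.2 one_ne_zero) hf hg
  simpa [sub_eq_add_neg] using this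

theorem doobSpaceTime_domain_le : (doobSpaceTime p q hρ hS E hp hq).domain ≤
    tensorSubmodule (hamiltonian₀ p q hρ hS E hp hq).domain timeDeriv.domain := by
  rw [doobSpaceTime, transport_domain, symmetrize_domain]
  refine Submodule.map_le_iff_le_comap.2 fun F hF => ?_
  -- An element common to `D(L) ⊗ H¹` and `D(L̃) ⊗ H¹` might a priori need different product
  -- expansions; it has one with all spatial factors in `D(L) ∩ D(L̃)`.
  have hF' := tensorSubmodule_inf _ _ _ _ ⟨hF.1.1, hF.2.1⟩
  rw [inf_idem] at hF'
  revert F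
  suffices h : tensorSubmodule ((markovGenerator p (densityMeasure ρ) hp).domain ⊓
      (markovGenerator q (densityMeasure ρ) hq).domain) timeDeriv.domain ≤
      (tensorSubmodule (hamiltonian₀ p q hρ hS E hp hq).domain timeDeriv.domain).comap
        (mulIsometry (measurable_waveΨ hρ hS E) (density_eq_Ψ hρ S E)).toLinearMap from
    fun F _ hF => h hF
  refine Submodule.span_le.2 ?_
  rintro _ ⟨f, hf, g, hg, rfl⟩
  refine Submodule.subset_span ⟨_, ?_, _, ?_, mulIsometry_tensorLp hρ hS E f g⟩
  · rw [hamiltonian₀_domain]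
    exact ⟨f, hf, rfl⟩
  · exact LinearPMap.mem_domain_of_mem_graph
      (mem_graph_timeDeriv_phaseOp E (timeDeriv.mem_graph ⟨g, hg⟩))

theorem tensorOp_sub_domain_le : (tensorOp (hamiltonian₀ p q hρ hS E hp hq)
      (idOp (Lp ℂ 2 (volume : Measure ℝ)))
      - Complex.I • tensorOp (idOp (Lp ℂ 2 (volume : Measure (Space n)))) timeDeriv).domain ≤
    tensorSubmodule (hamiltonian₀ p q hρ hS E hp hq).domain timeDeriv.domain := by
  rintro F ⟨h1, h2⟩
  have := tensorSubmodule_inf _ _ _ _ ⟨tensorOp_domain_le h1, tensorOp_domain_le h2⟩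
  have e1 : (hamiltonian₀ p q hρ hS E hp hq).domain ⊓
      (idOp (Lp ℂ 2 (volume : Measure (Space n)))).domain =
      (hamiltonian₀ p q hρ hS E hp hq).domain := inf_top_eq _
  have e2 : (idOp (Lp ℂ 2 (volume : Measure ℝ))).domain ⊓ timeDeriv.domain =
    timeDeriv.domain := top_inf_eq _
  rwa [e1, e2] at this

/-- `K^Y_Ψ = H₀ ⊗ I - i I ⊗ ∂_t`. -/
theorem doobSpaceTime_eq : doobSpaceTime p q hρ hS E hp hq =
    tensorOp (hamiltonian₀ p q hρ hS E hp hq) (idOp (Lp ℂ 2 (volume : Measure ℝ)))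
      - Complex.I • tensorOp (idOp (Lp ℂ 2 (volume : Measure (Space n)))) timeDeriv := by
  refine eq_of_span (doobSpaceTime_domain_le p q hρ hS E hp hq)
    (tensorOp_sub_domain_le p q hρ hS E hp hq) ?_
  rintro _ ⟨u, hu, h, hh, rfl⟩
  rw [hamiltonian₀_domain] at hu
  obtain ⟨f, ⟨hf1, hf2⟩, rfl⟩ := hu
  have hfa := (markovGenerator p (densityMeasure ρ) hp).mem_graph ⟨f, hf1⟩
  have hfb := (markovGenerator q (densityMeasure ρ) hq).mem_graph ⟨f, hf2⟩
  set a := markovGenerator p (densityMeasure ρ) hp ⟨f, hf1⟩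
  set b := markovGenerator q (densityMeasure ρ) hq ⟨f, hf2⟩
  have hg := mem_graph_timeDeriv_phaseOp (-E) (timeDeriv.mem_graph ⟨h, hh⟩)
  have hh' := phaseOp_phaseOp_neg E h
  simp only at hg
  set g := phaseOp (-E) h
  set g' := phaseOp (-E) (timeDeriv ⟨h, hh⟩) - (Complex.I * (-E : ℝ)) • g
  -- Here `g = e^{iEt} h`. Writing `h'` as `e^{-iEt} g' - iE h` puts both sides in the same terms.
  have hd := mem_graph_timeDeriv_phaseOp E hg
  rw [hh'] at hd
  refine ⟨_, ?_, mem_graph_sub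
    (mem_graph_tensorOp (mem_graph_transport_add E (mem_graph_symmetrize hfa hfb))
      (mem_graph_idOp h))
    (mem_graph_smul _ (mem_graph_tensorOp (mem_graph_idOp _) hd))⟩
  have hL := mem_graph_transport (U := mulIsometry (measurable_waveΨ hρ hS E)
    (density_eq_Ψ hρ S E)) (mem_graph_symmetrize (mem_graph_spaceTimeForward hp hfa hg)
      (mem_graph_spaceTimeBackward hq hfb hg))
  simp only [map_neg, map_smul, map_add, map_sub, mulIsometry_tensorLp hρ hS, hh'] at hL
  rw [map_neg, map_smul, map_add, map_smul, LinearIsometry.coe_toLinearMap,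
    tensorLp_symmetrize_identity]
  exact hL

end Hamiltonian

/-! ### The eigenvector `ψ` and semiboundedness of `K` -/

section GroundState

variable {n : ℕ} {p q : ℝ≥0 → Kernel (Space n) (Space n)}
  [∀ t, IsMarkovKernel (p t)] [∀ t, IsMarkovKernel (q t)]
  {ρ S : Space n → ℝ} (hρ : Measurable ρ) (hS : Measurable S) (E : ℝ)
  (hp : ∀ t, (p t).Invariant (densityMeasure ρ)) (hq : ∀ t, (q t).Invariant (densityMeasure ρ))

theorem waveψ_ne_zero {x : Space n} (hx : 0 < ρ x) : waveψ ρ S x ≠ 0 :=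
  mul_ne_zero (by exact_mod_cast (Real.sqrt_pos.2 hx).ne') (Complex.exp_ne_zero _)

include hρ hS in
theorem isFiniteMeasure_of_memLp (hψ : MemLp (waveψ ρ S) 2 (volume : Measure (Space n))) :
    IsFiniteMeasure (densityMeasure ρ) := by
  refine ⟨?_⟩
  have h := (memLp_two_iff_lintegral (measurable_waveψ hρ hS).aestronglyMeasurable).1 hψ
  simp_rw [enorm_waveψ_sq] at h
  rwa [densityMeasure, withDensity_apply _ MeasurableSet.univ, Measure.restrict_univ]

theorem toLp_waveψ_ne_zero (hpos : ∀ᵐ x : Space n, 0 < ρ x)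
    (hψ : MemLp (waveψ ρ S) 2 (volume : Measure (Space n))) : hψ.toLp _ ≠ 0 := by
  intro h0
  have h1 := (Lp.eq_zero_iff_ae_eq_zero.1 h0).symm.trans hψ.coeFn_toLp
  have h2 : ∀ᵐ _ : Space n, False := by
    filter_upwards [h1, hpos] with x h3 h4
    exact waveψ_ne_zero h4 h3.symm
  have h5 : (volume : Measure (Space n)) Set.univ = 0 := by simpa [ae_iff] using h2
  exact isOpen_univ.measure_ne_zero volume Set.univ_nonempty h5

/-- `H₀ ψ = E ψ`. -/
theorem mem_graph_hamiltonian₀_waveψ (hψ : MemLp (waveψ ρ S) 2 (volume : Measure (Space n))) :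
    (hψ.toLp _, (E : ℂ) • hψ.toLp _) ∈ (hamiltonian₀ p q hρ hS E hp hq).graph := by
  have := isFiniteMeasure_of_memLp hρ hS hψ
  have h1 : ((memLp_const (1 : ℂ)).toLp _, (0 : Lp ℂ 2 (densityMeasure ρ))) ∈
      (markovGenerator p (densityMeasure ρ) hp).graph :=
    mem_graph_generator_of_fixed fun t => transitionOp_one (hp t)
  have h2 : ((memLp_const (1 : ℂ)).toLp _, (0 : Lp ℂ 2 (densityMeasure ρ))) ∈
      (markovGenerator q (densityMeasure ρ) hq).graph :=
    mem_graph_generator_of_fixed fun t => transitionOp_one (hq t)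
  have h3 := mem_graph_transport_add E (U := mulIsometry (measurable_waveψ hρ hS)
    (density_eq_ψ ρ S)) (mem_graph_symmetrize h1 h2)
  -- The transform sends the constant `1`, annihilated by both generators, to `ψ`; only the shift
  -- `E` survives.
  rw [mulIsometry_toLp (measurable_waveψ hρ hS) (density_eq_ψ ρ S) (memLp_const (1 : ℂ)) hψ
    (ae_of_all _ fun _ => one_mul _), smul_zero, add_zero, smul_zero, neg_zero, map_zero,
    zero_add] at h3
  exact h3

theorem waveΨ_eq_phase (t : ℝ) :
    (fun x => waveΨ ρ S E (x, t)) = phase E t • waveψ ρ S :=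
  funext fun _ => mul_comm _ _

theorem isSymmetricSemibounded_symmetrize {H : Type*} [NormedAddCommGroup H]
    [InnerProductSpace ℂ H] {L L' : H →ₗ.[ℂ] H} (h : L'.IsFormalAdjoint L)
    (hd : Dense ((L.domain ⊓ L'.domain : Submodule ℂ H) : Set H))
    (hb : ∃ C : ℝ, ∀ φ : L.domain,
      C * ‖(φ : H)‖ ^ 2 ≤ -(inner ℂ (φ : H) (L φ)).re + (inner ℂ (φ : H) (L φ)).im) :
    IsSymmetricSemibounded (symmetrize L L') := by
  refine ⟨by rwa [symmetrize_domain], symmetrize_isFormalAdjoint h, ?_⟩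
  obtain ⟨C, hC⟩ := hb
  refine ⟨C, fun x => ?_⟩
  rw [re_inner_symmetrize h]
  exact hC ⟨x, x.2.2⟩

end GroundState

end DoobSchrodinger

end

/-! ### The proposition -/

open DoobSchrodinger in
theorem proposition5p2 {n : ℕ} {Ω : Type*} [MeasurableSpace Ω] (P : Measure Ω)
    (X : ℝ → Ω → Space n) (p q : ℝ≥0 → Kernel (Space n) (Space n))
    [∀ t, IsMarkovKernel (p t)] [∀ t, IsMarkovKernel (q t)]
    (hX : IsBilateralMarkov P X p q)
    (ρ : Space n → ℝ) (hρm : Measurable ρ)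
    (hμ : IsInvariantMeasure P X p q (densityMeasure ρ))
    (hρ : ∀ᵐ x : Space n, 0 < ρ x)
    (hdense : Dense (((markovGenerator p (densityMeasure ρ) hμ.forward).domain ⊓
      (markovGenerator q (densityMeasure ρ) hμ.backward).domain :
        Submodule ℂ (Lp ℂ 2 (densityMeasure ρ))) : Set (Lp ℂ 2 (densityMeasure ρ))))
    (hbdd : ∃ C : ℝ, ∀ φ : (markovGenerator p (densityMeasure ρ) hμ.forward).domain,
      C * ‖(φ : Lp ℂ 2 (densityMeasure ρ))‖ ^ 2 ≤
        -(inner ℂ (φ : Lp ℂ 2 (densityMeasure ρ))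
            (markovGenerator p (densityMeasure ρ) hμ.forward φ)).re
          + (inner ℂ (φ : Lp ℂ 2 (densityMeasure ρ))
            (markovGenerator p (densityMeasure ρ) hμ.forward φ)).im)
    (S : Space n → ℝ) (hS : Measurable S) (E : ℝ) :
    -- `K^Y_Ψ = H₀ ⊗ I - i I ⊗ ∂_t`
    doobSpaceTime p q hρm hS E hμ.forward hμ.backward =
        tensorOp (hamiltonian₀ p q hρm hS E hμ.forward hμ.backward)
            (idOp (Lp ℂ 2 (volume : Measure ℝ)))
          - Complex.I • tensorOp (idOp (Lp ℂ 2 (volume : Measure (Space n)))) timeDeriv ∧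
    -- `H₀` is symmetric and bounded from below
    ∃ h₀ : IsSymmetricSemibounded (hamiltonian₀ p q hρm hS E hμ.forward hμ.backward),
      -- its Friedrichs extension `H` is a self-adjoint, bounded from below extension
      (hamiltonian₀ p q hρm hS E hμ.forward hμ.backward ≤ friedrichs _ h₀ ∧
        IsSelfAdjoint (friedrichs _ h₀) ∧ IsBoundedBelow (friedrichs _ h₀)) ∧
      -- when `ψ` is square integrable,
      ∀ hψ : MemLp (waveψ ρ S) 2 (volume : Measure (Space n)),
        -- it is an eigenvector with eigenvalue `E` of `H`
        (hψ.toLp _ ≠ 0 ∧ ∃ hd : hψ.toLp _ ∈ (friedrichs _ h₀).domain,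
          friedrichs _ h₀ ⟨hψ.toLp _, hd⟩ = (E : ℂ) • hψ.toLp _) ∧
        -- and `Ψ` is a strong solution of `i ∂_t Ψ = H Ψ` with `H Ψ = E Ψ` at all times
        ∃ hΨ : ∀ t : ℝ, MemLp (fun x => waveΨ ρ S E (x, t)) 2 (volume : Measure (Space n)),
          ∀ t : ℝ, ∃ hd : (hΨ t).toLp _ ∈ (friedrichs _ h₀).domain,
            friedrichs _ h₀ ⟨(hΨ t).toLp _, hd⟩ = (E : ℂ) • (hΨ t).toLp _ ∧
            ∃ d : Lp ℂ 2 (volume : Measure (Space n)),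
              HasDerivAt (fun s : ℝ => (hΨ s).toLp _) d t ∧
              Complex.I • d = friedrichs _ h₀ ⟨(hΨ t).toLp _, hd⟩ := by
  -- The Markov property enters here; what follows uses the process only through its semigroups.
  have hdual : (markovGenerator q (densityMeasure ρ) hμ.backward).IsFormalAdjoint
      (markovGenerator p (densityMeasure ρ) hμ.forward) :=
    generator_isFormalAdjoint fun t f g =>
      transitionOp_duality _ _ (compProd_map_swap hX hμ t) f g
  have hsurj : Function.Surjective (mulIsometry (measurable_waveψ hρm hS) (density_eq_ψ ρ S)) :=
    mulIsometry_surjective _ _ (hρ.mono fun x hx => waveψ_ne_zero hx)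
  have h₀ : IsSymmetricSemibounded (hamiltonian₀ p q hρm hS E hμ.forward hμ.backward) :=
    isSymmetricSemibounded_transport_add
      (isSymmetricSemibounded_symmetrize hdual hdense hbdd) hsurj E
  refine ⟨doobSpaceTime_eq p q hρm hS E hμ.forward hμ.backward, h₀,
    ⟨le_friedrichs h₀, friedrichs_isSelfAdjoint_isBoundedBelow h₀⟩, fun hψ => ?_⟩
  have hgraph := LinearPMap.le_graph_of_le (le_friedrichs h₀)
    (mem_graph_hamiltonian₀_waveψ hρm hS E hμ.forward hμ.backward hψ)
  have key : ∀ φ, (φ, (E : ℂ) • φ) ∈ (friedrichs _ h₀).graph →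
      ∃ hd : φ ∈ (friedrichs _ h₀).domain, friedrichs _ h₀ ⟨φ, hd⟩ = (E : ℂ) • φ := by
    intro φ hφ
    obtain ⟨x, rfl, hx⟩ := (LinearPMap.mem_graph_iff _).1 hφ
    exact ⟨x.2, hx⟩
  refine ⟨⟨toLp_waveψ_ne_zero hρ hψ, key _ hgraph⟩, ?_⟩
  have hΨ : ∀ t : ℝ, MemLp (fun x => waveΨ ρ S E (x, t)) 2 (volume : Measure (Space n)) :=
    fun t => by
      rw [waveΨ_eq_phase]
      exact hψ.const_smul _
  have hΨ_eq : ∀ t, (hΨ t).toLp _ = phase E t • hψ.toLp _ := fun t => by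
    rw [← MemLp.toLp_const_smul]
    exact MemLp.toLp_congr _ _ (ae_of_all _ fun x => congrFun (waveΨ_eq_phase E t) x)
  refine ⟨hΨ, fun t => ?_⟩
  have hgt : ((hΨ t).toLp _, (E : ℂ) • (hΨ t).toLp _) ∈ (friedrichs _ h₀).graph := by
    rw [hΨ_eq, smul_comm]
    exact (friedrichs _ h₀).graph.smul_mem (phase E t) hgraph
  obtain ⟨hd, hH⟩ := key _ hgt
  refine ⟨hd, hH, (-(Complex.I * E) * phase E t) • hψ.toLp _, ?_, ?_⟩
  · simp only [hΨ_eq]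
    exact (hasDerivAt_phase E t).smul_const _
  · rw [hH, hΨ_eq, smul_smul, smul_smul]
    congr 1
    linear_combination (-(E : ℂ) * phase E t) * Complex.I_mul_I
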